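/- **Definitions.** A cooperative game $(N,v)$ is a finite set $N$ of players with a function $v:2^N\to\mathbb{Q}$. Its Shapley value is the vector $(\varphi_i)_{i\in N}$ with $$\varphi_i=\frac1{|N|!}\sum_{S\subseteq N\setminus\{i\}}|S|!\,(|N|-|S|-1)!\,\bigl(v(S\cup\{i\})-v(S)\bigr).$$ A weighted graph $G=(N,E,w)$ is an undirected graph with weights $w:E\to\mathbb{Q}_{\ge0}$; it is unweighted if all weights are $1$. The game $(N,v)$ is subgraph-based, with associated weighted graph $G=(N,E,w)$, if $v(S)=v(T)$ for all $S,T\subseteq N$ whose induced weighted subgraphs $G(S)$ and $G(T)$ are isomorphic (edges and weights being preserved). A module of $G$ is a set $M\subseteq N$ all of whose members are connected to the same vertices outside $M$, by edges of the same weight. A clique (coclique) module is a module whose vertices are pairwise connected by edges of the same weight (pairwise disconnected). A modular decomposition is a partition of $N$ into modules. Running times are bit complexities, and numbers are written in binary. **Theorem.** Let $k$ be a constant, and consider a family of subgraph-based cooperative games $(N,v)$ with $N=\{1,\dots,n\}$, each with an associated weighted graph $G=(N,E,w)$ and a finite description $x$, such that 1. $G$ is given, i.e. is part of $x$, or can be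 computed from $x$ in time polynomial in the size of $x$; 2. $G$ has a modular decomposition into at most $k$ coclique modules, or $G$ is unweighted and has a modular decomposition into at most $k$ clique modules (the decomposition is not part of the input); 3. there is an algorithm that computes $v(S)$ from $x$ and $S\subseteq N$, for all $S\subseteq N$, in polynomial time. Then there is an algorithm that computes the Shapley value $(\varphi_1,\dots,\varphi_n)$ of $(N,v)$ from $x$ in time polynomial in the size of $x$. -/

import Mathlib

/-! ### Cooperative games and the Shapley value -/

/-- A (rational-valued) cooperative game on the player set `N`: its characteristic function. -/
abbrev CoopGame (N : Type*) := Finset N → ℚ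

/-- The raw Shapley value
`κ_i = ∑_{S ⊆ N \ {i}} |S|! (|N| - |S| - 1)! (v (S ∪ {i}) - v S)`. -/
def CoopGame.rawShapley {N : Type*} [Fintype N] [DecidableEq N] (v : CoopGame N) (i : N) : ℚ :=
  ∑ S ∈ (Finset.univ.erase i).powerset,
    (S.card.factorial : ℚ) * ((Fintype.card N - S.card - 1).factorial : ℚ) * (v (insert i S) - v S)

/-- The Shapley value `φ_i = κ_i / |N|!`. -/
def CoopGame.shapley {N : Type*} [Fintype N] [DecidableEq N] (v : CoopGame N) (i : N) : ℚ :=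
  v.rawShapley i / ((Fintype.card N).factorial : ℚ)

/-! ### Weighted graphs, modules -/

/-- An undirected graph with nonnegative rational edge weights. An edge may have weight `0`. -/
structure WeightedGraph (V : Type*) where
  graph : SimpleGraph V
  weight : graph.edgeSet → ℚ≥0

namespace WeightedGraph

variable {V W : Type*}

open Classical in
/-- `none` if `a` and `b` are not joined by an edge, `some w` if they are joined by an edge of
weight `w`. -/
noncomputable def link (G : WeightedGraph V) (a b : V) : Option ℚ≥0 :=
  if h : G.graph.Adj a b then some (G.weight ⟨s(a, b), h⟩) else none

/-- All edges have weight `1`. -/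
def IsUnweighted (G : WeightedGraph V) : Prop := ∀ e, G.weight e = 1

theorem map_val_mem_edgeSet (G : WeightedGraph V) (S : Set V)
    (e : Sym2 S) (he : e ∈ (G.graph.induce S).edgeSet) :
    e.map Subtype.val ∈ G.graph.edgeSet := by
  induction e with
  | h a b => simpa using he

/-- The weighted subgraph `G(S)` induced by `S`. -/
def induce (G : WeightedGraph V) (S : Set V) : WeightedGraph S where
  graph := G.graph.induce S
  weight e := G.weight ⟨e.1.map Subtype.val, G.map_val_mem_edgeSet S e.1 e.2⟩

/-- Weighted graphs are isomorphic if some bijection of the vertices preserves and reflects edges,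
and preserves their weights. -/
def Isomorphic (G : WeightedGraph V) (H : WeightedGraph W) : Prop :=
  ∃ f : V ≃ W, ∀ a b, H.link (f a) (f b) = G.link a b

/-- All vertices of `M` are joined to the same vertices outside `M`, by edges of the same weight. -/
def IsModule (G : WeightedGraph V) (M : Finset V) : Prop :=
  ∀ a ∈ M, ∀ b ∈ M, ∀ c ∉ M, G.link a c = G.link b c

/-- A module whose vertices are pairwise joined by edges of the same weight. -/
def IsCliqueModule (G : WeightedGraph V) (M : Finset V) : Prop :=
  G.IsModule M ∧ ∃ w : ℚ≥0, ∀ a ∈ M, ∀ b ∈ M, a ≠ b → G.link a b = some w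

/-- A module whose vertices are pairwise not joined by an edge. -/
def IsCocliqueModule (G : WeightedGraph V) (M : Finset V) : Prop :=
  G.IsModule M ∧ ∀ a ∈ M, ∀ b ∈ M, ¬ G.graph.Adj a b

/-- There is a modular decomposition into at most `k` clique modules. -/
def HasCliqueDecomposition [Fintype V] [DecidableEq V] (G : WeightedGraph V) (k : ℕ) : Prop :=
  ∃ γ : Finpartition (Finset.univ : Finset V),
    γ.parts.card ≤ k ∧ ∀ M ∈ γ.parts, G.IsCliqueModule M

/-- There is a modular decomposition into at most `k` coclique modules. -/
def HasCocliqueDecomposition [Fintype V] [DecidableEq V] (G : WeightedGraph V) (k : ℕ) : Prop :=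
  ∃ γ : Finpartition (Finset.univ : Finset V),
    γ.parts.card ≤ k ∧ ∀ M ∈ γ.parts, G.IsCocliqueModule M

end WeightedGraph

/-- The game `v` is subgraph-based, with associated weighted graph `G`: coalitions that induce
isomorphic weighted subgraphs have the same value. -/
def CoopGame.IsSubgraphBasedOn {N : Type*} (v : CoopGame N) (G : WeightedGraph N) : Prop :=
  ∀ S T : Finset N,
    (G.induce (S : Set N)).Isomorphic (G.induce (T : Set N)) → v S = v T

/-! ### Machine model: structured programs under the logarithmic (bit) cost criterion

A program works on natural-number registers and on growable arrays of natural numbers; a given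
program mentions only finitely many of each. Every arithmetic operation and every memory access is
charged the binary length of the numbers involved. All primitives can be carried out by a Turing
machine in time polynomial in the size of the memory, and the size of the memory never exceeds the
size of the input plus the cost, so that polynomial cost is polynomial time on a Turing machine,
and conversely. -/

namespace BitCost

/-- Contents of the memory. -/
structure State where
  reg : ℕ → ℕ
  arr : ℕ → List ℕ

/-- Expressions: literals, registers, the length of an array, an entry of an array (entries are
numbered from `0`; the value is `0` outside the array), and arithmetic of natural numbers
(truncated subtraction, integer division and remainder). -/
inductive Expr where
  | lit (c : ℕ)
  | reg (x : ℕ)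
  | len (l : ℕ)
  | get (l : ℕ) (e : Expr)
  | add (e f : Expr)
  | sub (e f : Expr)
  | mul (e f : Expr)
  | div (e f : Expr)
  | mod (e f : Expr)

/-- Value of an expression. -/
def Expr.eval (s : State) : Expr → ℕ
  | .lit c => c
  | .reg x => s.reg x
  | .len l => (s.arr l).length
  | .get l e => (s.arr l).getD (e.eval s) 0
  | .add e f => e.eval s + f.eval s
  | .sub e f => e.eval s - f.eval s
  | .mul e f => e.eval s * f.eval s
  | .div e f => e.eval s / f.eval s
  | .mod e f => e.eval s % f.eval s

/-- Cost of evaluating an expression: each subexpression is charged one plus the binary length of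
its value. -/
def Expr.cost (s : State) : Expr → ℕ
  | .lit c => c.size + 1
  | .reg x => (s.reg x).size + 1
  | .len l => (s.arr l).length.size + 1
  | .get l e => ((Expr.get l e).eval s).size + 1 + e.cost s
  | .add e f => ((Expr.add e f).eval s).size + 1 + e.cost s + f.cost s
  | .sub e f => ((Expr.sub e f).eval s).size + 1 + e.cost s + f.cost s
  | .mul e f => ((Expr.mul e f).eval s).size + 1 + e.cost s + f.cost s
  | .div e f => ((Expr.div e f).eval s).size + 1 + e.cost s + f.cost s
  | .mod e f => ((Expr.mod e f).eval s).size + 1 + e.cost s + f.cost s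

/-- Programs: do nothing, assign to a register, append an entry at the end of an array, empty an
array, sequential composition, `ite e P Q` (run `P` if `e ≠ 0`, otherwise `Q`) and `loop e P`
(while `e ≠ 0`, run `P`). -/
inductive Prog where
  | skip
  | assign (x : ℕ) (e : Expr)
  | append (l : ℕ) (e : Expr)
  | clear (l : ℕ)
  | seq (P Q : Prog)
  | ite (e : Expr) (P Q : Prog)
  | loop (e : Expr) (P : Prog)

/-- `Run P s t s'`: started in `s`, the program `P` terminates in `s'`, at total cost `t`. -/
inductive Run : Prog → State → ℕ → State → Prop where
  | skip (s : State) : Run .skip s 1 s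
  | assign (x : ℕ) (e : Expr) (s : State) :
      Run (.assign x e) s (1 + e.cost s) { s with reg := Function.update s.reg x (e.eval s) }
  | append (l : ℕ) (e : Expr) (s : State) :
      Run (.append l e) s (1 + e.cost s)
        { s with arr := Function.update s.arr l (s.arr l ++ [e.eval s]) }
  | clear (l : ℕ) (s : State) :
      Run (.clear l) s 1 { s with arr := Function.update s.arr l [] }
  | seq {P Q : Prog} {s s' s'' : State} {t t' : ℕ} :
      Run P s t s' → Run Q s' t' s'' → Run (.seq P Q) s (1 + t + t') s''
  | ite_true {e : Expr} {P Q : Prog} {s s' : State} {t : ℕ} :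
      e.eval s ≠ 0 → Run P s t s' → Run (.ite e P Q) s (1 + e.cost s + t) s'
  | ite_false {e : Expr} {P Q : Prog} {s s' : State} {t : ℕ} :
      e.eval s = 0 → Run Q s t s' → Run (.ite e P Q) s (1 + e.cost s + t) s'
  | loop_stop {e : Expr} {P : Prog} {s : State} :
      e.eval s = 0 → Run (.loop e P) s (1 + e.cost s) s
  | loop_step {e : Expr} {P : Prog} {s s' s'' : State} {t t' : ℕ} :
      e.eval s ≠ 0 → Run P s t s' → Run (.loop e P) s' t' s'' →
        Run (.loop e P) s (1 + e.cost s + t + t') s''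

/-- Size of a word of natural numbers written in binary. -/
def size (w : List ℕ) : ℕ := (w.map fun a => a.size + 1).sum

/-- The initial memory: the input is in array `0`, everything else is zero or empty. -/
def State.init (w : List ℕ) : State where
  reg _ := 0
  arr l := if l = 0 then w else []

/-- There is a single program that, for every `a`, started on `input a` terminates within time
polynomial in the size of `input a`, with `output a` in array `1`. -/
def PolyTimeComputable {ι : Type*} (input output : ι → List ℕ) : Prop :=
  ∃ (P : Prog) (p : Polynomial ℕ), ∀ a : ι, ∃ (t : ℕ) (s : State),
    Run P (State.init (input a)) t s ∧ t ≤ p.eval (size (input a)) ∧ s.arr 1 = output a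

/-! ### Encodings -/

/-- A pair of words. -/
def encodePair (w u : List ℕ) : List ℕ := w.length :: (w ++ u)

/-- A rational number: sign, numerator and denominator in lowest terms. -/
def encodeRat (q : ℚ) : List ℕ := [if q < 0 then 1 else 0, q.num.natAbs, q.den]

/-- A coalition: its characteristic vector. -/
def encodeCoalition {n : ℕ} (S : Finset (Fin n)) : List ℕ :=
  List.ofFn fun i => if i ∈ S then 1 else 0

/-- An entry of the adjacency matrix of a weighted graph: an edge flag, and numerator and
denominator of the weight. -/
def encodeLink : Option ℚ≥0 → List ℕ
  | none => [0, 0, 0]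
  | some w => [1, w.num, w.den]

/-- A weighted graph: the number of vertices, followed by the adjacency matrix, row by row. -/
noncomputable def encodeGraph {n : ℕ} (G : WeightedGraph (Fin n)) : List ℕ :=
  n :: (List.ofFn fun i => (List.ofFn fun j => encodeLink (G.link i j)).flatten).flatten

/-- The vector of the Shapley values of all players. -/
def encodeShapley {n : ℕ} (v : CoopGame (Fin n)) : List ℕ :=
  (List.ofFn fun i => encodeRat (v.shapley i)).flatten

end BitCost

/-! Call two vertices twins if every third vertex is linked in the same way to both. Being twins is
an equivalence relation (`WeightedGraph.Twin.trans`), and the link between two distinct vertices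
depends only on their twin classes (`WeightedGraph.Twin.link_eq`). Hence every bijection between
coalitions that preserves twin classes is an isomorphism of the induced graphs, and in a
subgraph-based game `v S` depends only on the profile of `S`, the number of its members in each
class (`WeightedGraph.isomorphic_of_card_eq`).

Two members of one clique or coclique module are twins, so a decomposition into at most `k` such
modules forces at most `k` twin classes (`WeightedGraph.card_image_firstTwin_le`). The decomposition
itself need not be found: the twin classes are read off the adjacency matrix, each labelled by its
least member `firstTwin`.

For a fixed player `i` there are at most `(n + 1) ^ k` profiles of coalitions without `i`
(`numProfiles_le`). They are numbered in mixed radix; the coalitions with a given profile are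
counted by a product of binomial coefficients, and one of them, with and without `i`, represents all
of them. Thus `rawShapley_eq_sum_profiles` turns the exponential sum into one with polynomially many
terms, each needing two calls of the value algorithm.

The remaining work is to carry this out in the machine model. Polynomial-time computability is shown
to be closed under composition, arithmetic, bounded loops (`PolyTimeComputable.iterate`) and bounded
quantifiers. The terms are added over the product of their denominators, which still has polynomial
length, and a gcd brings the result to lowest terms (`polyTimeComputable_encodeRat_sum`). -/

namespace BitCost

/-! ### Programming toolkit: polynomial-time computability and its closure properties. -/

/-! ### Sizes -/

@[simp] theorem size_nil : size [] = 0 := rfl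

@[simp] theorem size_cons (a : ℕ) (w : List ℕ) : size (a :: w) = a.size + 1 + size w := by
  simp [size]

@[simp] theorem size_append (w u : List ℕ) : size (w ++ u) = size w + size u := by
  simp [size]

theorem length_le_size (w : List ℕ) : w.length ≤ size w := by
  induction w with
  | nil => simp
  | cons a w ih => simp; omega

theorem size_getD_le (w : List ℕ) (i : ℕ) : (w.getD i 0).size ≤ size w := by
  induction w generalizing i with
  | nil => simp
  | cons a w ih =>
    cases i with
    | zero => simp; omega
    | succ i => have := ih i; simp at this ⊢; omega

theorem natSize_le_self (x : ℕ) : x.size ≤ x := Nat.size_le.2 Nat.lt_two_pow_self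

theorem natSize_mul_le (x y : ℕ) : (x * y).size ≤ x.size + y.size := by
  rw [Nat.size_le, pow_add]
  exact Nat.mul_lt_mul'' (Nat.lt_size_self x) (Nat.lt_size_self y)

theorem natSize_add_le (x y : ℕ) : (x + y).size ≤ x.size + y.size := by
  rw [Nat.size_le, pow_add]
  have hx := Nat.lt_size_self x
  have hy := Nat.lt_size_self y
  nlinarith [Nat.zero_le x, Nat.zero_le y]

/-! ### Polynomial bounds -/

theorem eval_mono (p : Polynomial ℕ) {x y : ℕ} (h : x ≤ y) : p.eval x ≤ p.eval y := by
  simp only [Polynomial.eval_eq_sum, Polynomial.sum]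
  gcongr

/-- `X` is bounded by a polynomial in the size of the input. -/
def PolyBounded {ι : Type*} (code : ι → List ℕ) (X : ι → ℕ) : Prop :=
  ∃ p : Polynomial ℕ, ∀ a, X a ≤ p.eval (size (code a))

namespace PolyBounded

variable {ι : Type*} {code : ι → List ℕ} {X Y : ι → ℕ}

theorem mono (hY : PolyBounded code Y) (h : ∀ a, X a ≤ Y a) : PolyBounded code X :=
  let ⟨p, hp⟩ := hY
  ⟨p, fun a => (h a).trans (hp a)⟩

theorem const (c : ℕ) : PolyBounded code fun _ => c := ⟨Polynomial.C c, by simp⟩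

theorem input : PolyBounded code fun a => size (code a) := ⟨Polynomial.X, by simp⟩

theorem add (hX : PolyBounded code X) (hY : PolyBounded code Y) :
    PolyBounded code fun a => X a + Y a := by
  obtain ⟨p, hp⟩ := hX
  obtain ⟨q, hq⟩ := hY
  exact ⟨p + q, fun a => by rw [Polynomial.eval_add]; exact add_le_add (hp a) (hq a)⟩

theorem mul (hX : PolyBounded code X) (hY : PolyBounded code Y) :
    PolyBounded code fun a => X a * Y a := by
  obtain ⟨p, hp⟩ := hX
  obtain ⟨q, hq⟩ := hY
  exact ⟨p * q, fun a => by rw [Polynomial.eval_mul]; exact Nat.mul_le_mul (hp a) (hq a)⟩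

theorem pow (hX : PolyBounded code X) (k : ℕ) : PolyBounded code fun a => X a ^ k := by
  obtain ⟨p, hp⟩ := hX
  exact ⟨p ^ k, fun a => by rw [Polynomial.eval_pow]; exact Nat.pow_le_pow_left (hp a) k⟩

theorem eval (hX : PolyBounded code X) (p : Polynomial ℕ) :
    PolyBounded code fun a => p.eval (X a) := by
  obtain ⟨q, hq⟩ := hX
  exact ⟨p.comp q, fun a => by rw [Polynomial.eval_comp]; exact eval_mono p (hq a)⟩

theorem comp {mid : ι → List ℕ} (hX : PolyBounded mid X)
    (hm : PolyBounded code fun a => size (mid a)) : PolyBounded code X := by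
  obtain ⟨p, hp⟩ := hX
  exact (hm.eval p).mono hp

theorem restrict {κ : Type*} (g : κ → ι) (hX : PolyBounded code X) :
    PolyBounded (fun b => code (g b)) fun b => X (g b) :=
  let ⟨p, hp⟩ := hX
  ⟨p, fun b => hp (g b)⟩

end PolyBounded

/-! ### Renaming the memory of a program -/

/-- Rename registers along `ρ` and arrays along `σ`. -/
def Expr.rename (ρ σ : ℕ → ℕ) : Expr → Expr
  | .lit c => .lit c
  | .reg x => .reg (ρ x)
  | .len l => .len (σ l)
  | .get l e => .get (σ l) (e.rename ρ σ)
  | .add e f => .add (e.rename ρ σ) (f.rename ρ σ)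
  | .sub e f => .sub (e.rename ρ σ) (f.rename ρ σ)
  | .mul e f => .mul (e.rename ρ σ) (f.rename ρ σ)
  | .div e f => .div (e.rename ρ σ) (f.rename ρ σ)
  | .mod e f => .mod (e.rename ρ σ) (f.rename ρ σ)

/-- Rename registers along `ρ` and arrays along `σ`. -/
def Prog.rename (ρ σ : ℕ → ℕ) : Prog → Prog
  | .skip => .skip
  | .assign x e => .assign (ρ x) (e.rename ρ σ)
  | .append l e => .append (σ l) (e.rename ρ σ)
  | .clear l => .clear (σ l)
  | .seq P Q => .seq (P.rename ρ σ) (Q.rename ρ σ)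
  | .ite e P Q => .ite (e.rename ρ σ) (P.rename ρ σ) (Q.rename ρ σ)
  | .loop e P => .loop (e.rename ρ σ) (P.rename ρ σ)

/-- The memory of `S` seen through the renaming is `s`. -/
def Sees (ρ σ : ℕ → ℕ) (S s : State) : Prop :=
  (∀ x, S.reg (ρ x) = s.reg x) ∧ ∀ l, S.arr (σ l) = s.arr l

theorem Expr.eval_rename {ρ σ : ℕ → ℕ} {S s : State} (h : Sees ρ σ S s) (e : Expr) :
    (e.rename ρ σ).eval S = e.eval s := by
  induction e <;> simp_all [Expr.rename, Expr.eval, h.1, h.2]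

theorem Expr.cost_rename {ρ σ : ℕ → ℕ} {S s : State} (h : Sees ρ σ S s) (e : Expr) :
    (e.rename ρ σ).cost S = e.cost s := by
  induction e <;> simp_all [Expr.rename, Expr.cost, Expr.eval, Expr.eval_rename h, h.1, h.2]

theorem Run.of_eq {P : Prog} {s s' s'' : State} {t t' : ℕ} (h : Run P s t s') (ht : t = t')
    (hs : s' = s'') : Run P s t' s'' := ht ▸ hs ▸ h

/-- Costs depend only on values, which the renaming preserves; injectivity keeps distinct cells
distinct, so an update is seen in exactly one place. That cells outside the two ranges are untouched
is what protects the memory of a caller. -/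
theorem Run.rename {ρ σ : ℕ → ℕ} (hρ : ρ.Injective) (hσ : σ.Injective) {P : Prog} {s s' : State}
    {t : ℕ} (h : Run P s t s') (S : State) (hS : Sees ρ σ S s) :
    ∃ S', Run (P.rename ρ σ) S t S' ∧ Sees ρ σ S' s' ∧
      (∀ y, (∀ x, ρ x ≠ y) → S'.reg y = S.reg y) ∧ ∀ y, (∀ x, σ x ≠ y) → S'.arr y = S.arr y := by
  induction h generalizing S with
  | skip s => exact ⟨S, .skip S, hS, fun _ _ => rfl, fun _ _ => rfl⟩
  | assign x e s =>
    refine ⟨⟨Function.update S.reg (ρ x) (e.eval s), S.arr⟩,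
      (Run.assign _ _ S).of_eq (by rw [Expr.cost_rename hS]) (by rw [Expr.eval_rename hS]),
      ⟨fun y => ?_, hS.2⟩, fun y hy => ?_, fun _ _ => rfl⟩
    · simp [Function.update_apply, hρ.eq_iff, hS.1]
    · simp [(hy x).symm]
  | append l e s =>
    refine ⟨⟨S.reg, Function.update S.arr (σ l) (s.arr l ++ [e.eval s])⟩,
      (Run.append _ _ S).of_eq (by rw [Expr.cost_rename hS]) (by rw [Expr.eval_rename hS, hS.2]),
      ⟨hS.1, fun y => ?_⟩, fun _ _ => rfl, fun y hy => ?_⟩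
    · simp [Function.update_apply, hσ.eq_iff, hS.2]
    · simp [(hy l).symm]
  | clear l s =>
    refine ⟨_, .clear _ S, ⟨hS.1, fun y => ?_⟩, fun _ _ => rfl, fun y hy => ?_⟩
    · simp [Function.update_apply, hσ.eq_iff, hS.2]
    · simp [(hy l).symm]
  | seq _ _ ih₁ ih₂ =>
    obtain ⟨S₁, h₁, hS₁, hr₁, ha₁⟩ := ih₁ S hS
    obtain ⟨S₂, h₂, hS₂, hr₂, ha₂⟩ := ih₂ S₁ hS₁
    exact ⟨S₂, .seq h₁ h₂, hS₂, fun y hy => (hr₂ y hy).trans (hr₁ y hy),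
      fun y hy => (ha₂ y hy).trans (ha₁ y hy)⟩
  | ite_true he _ ih =>
    obtain ⟨S₁, h₁, hS₁⟩ := ih S hS
    exact ⟨S₁, Expr.cost_rename hS _ ▸ .ite_true (by rwa [Expr.eval_rename hS]) h₁, hS₁⟩
  | ite_false he _ ih =>
    obtain ⟨S₁, h₁, hS₁⟩ := ih S hS
    exact ⟨S₁, Expr.cost_rename hS _ ▸ .ite_false (by rwa [Expr.eval_rename hS]) h₁, hS₁⟩
  | loop_stop he =>
    exact ⟨S, Expr.cost_rename hS _ ▸ Run.loop_stop (by rwa [Expr.eval_rename hS]), hS,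
      fun _ _ => rfl, fun _ _ => rfl⟩
  | loop_step he _ _ ih₁ ih₂ =>
    obtain ⟨S₁, h₁, hS₁, hr₁, ha₁⟩ := ih₁ S hS
    obtain ⟨S₂, h₂, hS₂, hr₂, ha₂⟩ := ih₂ S₁ hS₁
    exact ⟨S₂, Expr.cost_rename hS _ ▸ .loop_step (by rwa [Expr.eval_rename hS]) h₁ h₂, hS₂,
      fun y hy => (hr₂ y hy).trans (hr₁ y hy), fun y hy => (ha₂ y hy).trans (ha₁ y hy)⟩

/-! ### Execution within a time bound -/

theorem State.eq_of {s s' : State} (hr : ∀ x, s.reg x = s'.reg x) (ha : ∀ l, s.arr l = s'.arr l) :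
    s = s' := by
  cases s; cases s'; simp only [State.mk.injEq]; exact ⟨funext hr, funext ha⟩

/-- Started in `s`, the program `P` terminates in `s'` at cost at most `T`. -/
def Exec (P : Prog) (s : State) (T : ℕ) (s' : State) : Prop := ∃ t ≤ T, Run P s t s'

theorem Run.exec {P : Prog} {s s' : State} {t : ℕ} (h : Run P s t s') : Exec P s t s' :=
  ⟨t, le_rfl, h⟩

theorem Exec.mono {P : Prog} {s s' : State} {T T' : ℕ} (h : Exec P s T s') (hT : T ≤ T') :
    Exec P s T' s' :=
  let ⟨t, ht, hr⟩ := h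
  ⟨t, ht.trans hT, hr⟩

theorem Exec.of_eq {P : Prog} {s s' s'' : State} {T T' : ℕ} (h : Exec P s T s') (hT : T ≤ T')
    (hs : s' = s'') : Exec P s T' s'' := hs ▸ h.mono hT

theorem Exec.seq {P Q : Prog} {s s' s'' : State} {T T' : ℕ} (h : Exec P s T s')
    (h' : Exec Q s' T' s'') : Exec (.seq P Q) s (1 + T + T') s'' := by
  obtain ⟨t, ht, hr⟩ := h
  obtain ⟨t', ht', hr'⟩ := h'
  exact ⟨_, by omega, .seq hr hr'⟩

theorem Exec.loop_step {P : Prog} {e : Expr} {s s' s'' : State} {T T' : ℕ} (he : e.eval s ≠ 0)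
    (h : Exec P s T s') (h' : Exec (.loop e P) s' T' s'') :
    Exec (.loop e P) s (1 + e.cost s + T + T') s'' := by
  obtain ⟨t, ht, hr⟩ := h
  obtain ⟨t', ht', hr'⟩ := h'
  exact ⟨_, by omega, .loop_step he hr hr'⟩

/-- An appended entry has already been charged its own length when its expression was evaluated. So
outputs of polynomial-time programs have polynomial size, which composition needs. -/
theorem Run.size_arr_le {P : Prog} {s s' : State} {t : ℕ} (h : Run P s t s') (l : ℕ) :
    size (s'.arr l) ≤ size (s.arr l) + t := by
  induction h with
  | append l' e s =>
    have : (e.eval s).size + 1 ≤ e.cost s := by cases e <;> simp [Expr.cost, Expr.eval] <;> omega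
    by_cases hl : l = l'
    · subst hl; simp; omega
    · simp [hl]
  | clear l' s =>
    by_cases hl : l = l'
    · subst hl; simp
    · simp [hl]
  | skip | assign | loop_stop => simp
  | _ => omega

/-! ### Subroutines -/

/-- All registers and arrays that the program changes have a number below the bound. -/
def Prog.bound : Prog → ℕ
  | .skip => 0
  | .assign x _ => x + 1
  | .append l _ => l + 1
  | .clear l => l + 1
  | .seq P Q => max P.bound Q.bound
  | .ite _ P Q => max P.bound Q.bound
  | .loop _ P => P.bound

theorem Run.eq_of_bound_le {P : Prog} {s s' : State} {t : ℕ} (h : Run P s t s') {x : ℕ}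
    (hx : P.bound ≤ x) : s'.reg x = s.reg x ∧ s'.arr x = s.arr x := by
  induction h with
  | assign y e s =>
    have : x ≠ y := by simp [Prog.bound] at hx; omega
    simp [this]
  | append y e s =>
    have : x ≠ y := by simp [Prog.bound] at hx; omega
    simp [this]
  | clear y s =>
    have : x ≠ y := by simp [Prog.bound] at hx; omega
    simp [this]
  | _ => simp_all [Prog.bound]

/-- Reset all registers below `K` and all arrays below `K`, except array `1`. -/
def reset : ℕ → Prog
  | 0 => .skip
  | K + 1 => .seq (reset K) (.seq (.assign K (.lit 0)) (if K = 1 then .skip else .clear K))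

theorem exec_reset (K : ℕ) (s : State) :
    Exec (reset K) s (6 * K + 1) ⟨fun x => if x < K then 0 else s.reg x,
      fun l => if l < K ∧ l ≠ 1 then [] else s.arr l⟩ := by
  induction K with
  | zero => exact (Run.skip s).exec.of_eq le_rfl (State.eq_of (by simp) (by simp))
  | succ K ih =>
    have key : ∀ s₁ : State, Exec (if K = 1 then .skip else .clear K) s₁ 1
        ⟨s₁.reg, if K = 1 then s₁.arr else Function.update s₁.arr K []⟩ := by
      intro s₁
      split_ifs
      · exact (Run.skip s₁).exec
      · exact (Run.clear K s₁).exec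
    have h := ih.seq ((Run.assign K (.lit 0) _).exec.seq (key _))
    simp only [Expr.eval, Expr.cost, Nat.size_zero] at h
    refine h.of_eq (by simp; omega) (State.eq_of (fun x => ?_) (fun l => ?_))
    · rcases lt_trichotomy x K with h | h | h
      · simp [h, h.ne, Nat.lt_succ_of_lt h]
      · simp [h]
      · simp [h.ne', Nat.not_lt.2 h.le, show ¬ x < K + 1 by omega]
    · by_cases hK : K = 1
      · subst hK
        rcases l with _ | _ | l <;> simp
      · rcases lt_trichotomy l K with h | h | h
        · simp [h, h.ne, Nat.lt_succ_of_lt h, hK]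
        · simp [h, hK]
        · simp [h.ne', Nat.not_lt.2 h.le, show ¬ l < K + 1 by omega, hK]

/-- The memory that is empty but for array `1`. -/
def State.final (w : List ℕ) : State where
  reg _ := 0
  arr l := if l = 1 then w else []

/-- A polynomial time computation can clean up behind itself. -/
theorem PolyTimeComputable.exists_exec {ι : Type*} {input output : ι → List ℕ}
    (h : PolyTimeComputable input output) :
    ∃ (P : Prog) (T : ι → ℕ), PolyBounded input T ∧
      ∀ a, Exec P (State.init (input a)) (T a) (State.final (output a)) := by
  obtain ⟨P, p, hP⟩ := h
  -- The `+ 2` brings the input array `0` into the range of the reset even if `P` never writes to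
  -- it.
  refine ⟨.seq P (reset (P.bound + 2)), fun a => 1 + p.eval (size (input a)) +
    (6 * (P.bound + 2) + 1), ?_, fun a => ?_⟩
  · exact ((PolyBounded.const 1).add (PolyBounded.input.eval p)).add (.const _)
  · obtain ⟨t, s, hr, ht, hs⟩ := hP a
    refine (Exec.seq ⟨t, ht, hr⟩ (exec_reset (P.bound + 2) s)).of_eq le_rfl
      (State.eq_of (fun x => ?_) (fun l => ?_))
    · by_cases hx : x < P.bound + 2
      · simp [State.final, hx]
      · simp [State.final, hx, (hr.eq_of_bound_le (show P.bound ≤ x by omega)).1, State.init]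
    · by_cases hl : l = 1
      · simp [State.final, hl, hs]
      · by_cases hx : l < P.bound + 2
        · simp [State.final, hl, hx]
        · simp [State.final, hl, hx, (hr.eq_of_bound_le (show P.bound ≤ l by omega)).2,
            State.init, show l ≠ 0 by omega]

/-- The output of a polynomial time computation has polynomial size. -/
theorem PolyTimeComputable.polyBounded {ι : Type*} {input output : ι → List ℕ}
    (h : PolyTimeComputable input output) : PolyBounded input fun a => size (output a) := by
  obtain ⟨P, p, hP⟩ := h
  refine ⟨p, fun a => ?_⟩
  obtain ⟨t, s, hr, ht, hs⟩ := hP a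
  have := hr.size_arr_le 1
  simp only [State.init, hs, if_neg one_ne_zero, size_nil, zero_add] at this
  exact this.trans ht

/-- Arrays of a subroutine with input in array `i` and output in array `o`. -/
def callArr (i o : ℕ) : ℕ → ℕ
  | 0 => i
  | 1 => o
  | l + 2 => l + 8

/-- Run `P` as a subroutine with input in array `i` and output in array `o`. -/
def call (P : Prog) (i o : ℕ) : Prog := P.rename (· + 8) (callArr i o)

/-- Cells below `8` belong to the caller; the private cells of the subroutine are shifted beyond
them. They must be blank at the start, and they are blank again at the end because the subroutine
stops in `State.final`, so calls can be chained and placed inside loops. The input array is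
consumed. -/
theorem exec_call {P : Prog} {w u : List ℕ} {T : ℕ}
    (h : Exec P (State.init w) T (State.final u)) {S : State} {i o : ℕ} (hi : i < 8) (ho : o < 8)
    (hio : i ≠ o) (hreg : ∀ x, S.reg (x + 8) = 0) (harr : ∀ l, S.arr (l + 8) = [])
    (hSi : S.arr i = w) (hSo : S.arr o = []) :
    Exec (call P i o) S T ⟨S.reg, Function.update (Function.update S.arr i []) o u⟩ := by
  obtain ⟨t, ht, hr⟩ := h
  have hσ : (callArr i o).Injective := by
    intro x y hxy
    rcases x with _ | _ | x <;> rcases y with _ | _ | y <;> simp_all [callArr] <;> omega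
  obtain ⟨S', hr', hS', hreg', harr'⟩ := hr.rename (add_left_injective 8) hσ S
    ⟨fun x => by simp [hreg, State.init], fun l => by
      rcases l with _ | _ | l <;> simp [callArr, State.init, hSi, hSo, harr]⟩
  refine ⟨t, ht, hr'.of_eq rfl (State.eq_of (fun x => ?_) (fun l => ?_))⟩
  · change S'.reg x = S.reg x
    by_cases hx : x < 8
    · exact hreg' x fun y => by simp; omega
    · obtain ⟨y, rfl⟩ := Nat.exists_eq_add_of_le' (not_lt.1 hx)
      simpa [hreg, State.final] using hS'.1 y
  · have h0 := hS'.2 0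
    have h1 := hS'.2 1
    simp only [callArr, State.final] at h0 h1
    by_cases hlo : l = o
    · subst hlo; simp [h1]
    by_cases hli : l = i
    · subst hli; simp [hlo, h0]
    simp only [Function.update_apply, hlo, hli, if_false]
    by_cases hx : l < 8
    · refine harr' l fun y => ?_
      rcases y with _ | _ | y <;> simp [callArr] <;> omega
    · obtain ⟨y, rfl⟩ := Nat.exists_eq_add_of_le' (not_lt.1 hx)
      simpa [callArr, harr, State.final] using hS'.2 (y + 2)


/-! ### Copying arrays -/

/-- Append the entries `x, …, y - 1` of the array `src` to the array `dst`, where `x` and `y` are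
the contents of registers `0` and `1`. -/
def copyLoop (src dst : ℕ) : Prog :=
  .loop (.sub (.reg 1) (.reg 0))
    (.seq (.append dst (.get src (.reg 0))) (.assign 0 (.add (.reg 0) (.lit 1))))

theorem exec_copyLoop {src dst : ℕ} (hsd : src ≠ dst) (d : ℕ) :
    ∀ (r : ℕ → ℕ) (A : ℕ → List ℕ) (x : ℕ), r 0 = x → r 1 = x + d → x + d ≤ (A src).length →
    Exec (copyLoop src dst) ⟨r, A⟩ (d * (7 * size (A src) + 13) + 2 * size (A src) + 4)
      ⟨Function.update r 0 (x + d),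
        Function.update A dst (A dst ++ ((A src).drop x).take d)⟩ := by
  induction d with
  | zero =>
    intro r A x h0 h1 hl
    have hx := natSize_le_self x
    have hZ := length_le_size (A src)
    refine (Run.loop_stop (by simp [Expr.eval, h0, h1])).exec.of_eq ?_ ?_
    · simp [Expr.cost, Expr.eval, h0, h1]
      omega
    · rw [add_zero, ← h0]; simp
  | succ d ih =>
    intro r A x h0 h1 hl
    have hZ := length_le_size (A src)
    have hlt : x < (A src).length := by omega
    have hstep := ((Run.append dst (.get src (.reg 0)) ⟨r, A⟩).exec.seq
      (Run.assign 0 (.add (.reg 0) (.lit 1)) _).exec).of_eq le_rfl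
      (s'' := ⟨Function.update r 0 (x + 1), Function.update A dst (A dst ++ [(A src)[x]])⟩)
      (by simp [Expr.eval, h0, hlt])
    have hrec := ih (Function.update r 0 (x + 1))
      (Function.update A dst (A dst ++ [(A src)[x]])) (x + 1) (by simp)
      (by simp [h1]; omega) (by simp [hsd]; omega)
    simp only [Function.update_of_ne hsd, Function.update_self, Function.update_idem] at hrec
    refine (Exec.loop_step (by simp [Expr.eval, h0, h1]) hstep hrec).of_eq ?_ ?_
    · have h2 := size_getD_le (A src) x
      have h3 := natSize_le_self x
      have h4 := natSize_le_self (x + 1)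
      have h5 := natSize_le_self (x + (d + 1))
      have h6 := natSize_le_self (d + 1)
      have h7 : (d + 1) * (7 * size (A src) + 13) =
        d * (7 * size (A src) + 13) + (7 * size (A src) + 13) := by ring
      simp only [Expr.cost, Expr.eval, h0, h1, Nat.add_sub_cancel_left, Nat.size_one, h7]
      omega
    · congr 2
      · omega
      · rw [List.append_assoc, List.drop_eq_getElem_cons hlt, List.take_succ_cons,
          List.singleton_append]

/-- Append the entries `b₁, …, b₂ - 1` of the array `src` to the array `dst`, where `b₁` and `b₂`
are the values of `e₁` and `e₂`. -/
def copyRange (src dst : ℕ) (e₁ e₂ : Expr) : Prog :=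
  .seq (.assign 0 e₁) (.seq (.assign 1 e₂) (.seq (copyLoop src dst)
    (.seq (.assign 0 (.lit 0)) (.assign 1 (.lit 0)))))

/-- A bound for the cost of `copyRange`. -/
def copyCost (C Z : ℕ) : ℕ := 2 * C + 7 * (Z * Z) + 15 * Z + 16

theorem copyCost_mono {C C' Z Z' : ℕ} (hC : C ≤ C') (hZ : Z ≤ Z') :
    copyCost C Z ≤ copyCost C' Z' := by
  unfold copyCost; gcongr

theorem PolyBounded.copyCost {ι : Type*} {code : ι → List ℕ} {X Y : ι → ℕ}
    (hX : PolyBounded code X) (hY : PolyBounded code Y) :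
    PolyBounded code fun a => copyCost (X a) (Y a) :=
  ((((const 2).mul hX).add ((const 7).mul (hY.mul hY))).add ((const 15).mul hY)).add (const 16)

/-- `he₁` and `he₂` range over all registers because register `0` has already been overwritten when
`e₂` is evaluated. Both work registers are returned to `0`, as the next copy requires. -/
theorem exec_copyRange {src dst b₁ b₂ C : ℕ} {e₁ e₂ : Expr} (hsd : src ≠ dst) (S : State)
    (h0 : S.reg 0 = 0) (h1 : S.reg 1 = 0)
    (he₁ : ∀ r, e₁.eval ⟨r, S.arr⟩ = b₁ ∧ e₁.cost ⟨r, S.arr⟩ ≤ C)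
    (he₂ : ∀ r, e₂.eval ⟨r, S.arr⟩ = b₂ ∧ e₂.cost ⟨r, S.arr⟩ ≤ C) (hb : b₁ ≤ b₂)
    (hb₂ : b₂ ≤ (S.arr src).length) :
    Exec (copyRange src dst e₁ e₂) S (copyCost C (size (S.arr src)))
      ⟨S.reg, Function.update S.arr dst (S.arr dst ++ ((S.arr src).drop b₁).take (b₂ - b₁))⟩ := by
  obtain ⟨r, A⟩ := S
  have h := (Run.assign 0 e₁ ⟨r, A⟩).exec.seq ((Run.assign 1 e₂ _).exec.seq
    ((exec_copyLoop hsd (b₂ - b₁) _ A b₁ (by simp [(he₁ _).1]) (by simp [(he₂ _).1]; omega)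
      (by simpa [hb] using hb₂)).seq
      ((Run.assign 0 (.lit 0) _).exec.seq (Run.assign 1 (.lit 0) _).exec)))
  refine h.of_eq ?_ ?_
  · have h2 := (he₁ r).2
    have h3 := (he₂ (Function.update r 0 (e₁.eval ⟨r, A⟩))).2
    have hd : b₂ - b₁ ≤ size (A src) := by have := length_le_size (A src); simp at hb₂; omega
    have h4 : (b₂ - b₁) * (7 * size (A src) + 13) ≤ size (A src) * (7 * size (A src) + 13) :=
      Nat.mul_le_mul_right _ hd
    have h5 : size (A src) * (7 * size (A src) + 13) =
      7 * (size (A src) * size (A src)) + 13 * size (A src) := by ring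
    simp only [Expr.cost, Nat.size_zero, copyCost]
    dsimp only at h2 h3
    omega
  · refine State.eq_of (fun x => ?_) (fun l => rfl)
    rcases x with _ | _ | x
    · simpa [Expr.eval] using h0.symm
    · simpa [Expr.eval] using h1.symm
    · simp

/-- Append the array `src` to the array `dst`. -/
def copy (src dst : ℕ) : Prog := copyRange src dst (.lit 0) (.len src)

theorem exec_copy {src dst : ℕ} (hsd : src ≠ dst) (S : State) (h0 : S.reg 0 = 0)
    (h1 : S.reg 1 = 0) {Z : ℕ} (hZ : size (S.arr src) ≤ Z) :
    Exec (copy src dst) S (copyCost (Z + 1) Z)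
      ⟨S.reg, Function.update S.arr dst (S.arr dst ++ S.arr src)⟩ := by
  have hlen := length_le_size (S.arr src)
  refine (exec_copyRange (C := Z + 1) hsd S h0 h1
    (fun r => ⟨rfl, by simp [Expr.cost]⟩) (fun r => ⟨rfl, ?_⟩) (Nat.zero_le _) le_rfl).of_eq
    (copyCost_mono le_rfl hZ) (by simp)
  have := natSize_le_self (S.arr src).length
  simp only [Expr.cost]
  omega

/-! ### Elementary computations -/

/-- A memory with four registers and five arrays in use. -/
def mem (r₀ r₁ r₂ r₃ : ℕ) (a₀ a₁ a₂ a₃ a₄ : List ℕ) : State where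
  reg | 0 => r₀ | 1 => r₁ | 2 => r₂ | 3 => r₃ | _ => 0
  arr | 0 => a₀ | 1 => a₁ | 2 => a₂ | 3 => a₃ | 4 => a₄ | _ => []

section mem

variable {r₀ r₁ r₂ r₃ : ℕ} {a₀ a₁ a₂ a₃ a₄ : List ℕ}

theorem init_eq_mem (w : List ℕ) : State.init w = mem 0 0 0 0 w [] [] [] [] :=
  State.eq_of (fun x => by rcases x with _ | _ | _ | _ | x <;> rfl)
    fun l => by rcases l with _ | _ | _ | _ | _ | l <;> rfl

theorem mem_ext {S : State} (h₀ : S.reg 0 = r₀) (h₁ : S.reg 1 = r₁) (h₂ : S.reg 2 = r₂)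
    (h₃ : S.reg 3 = r₃) (h : ∀ x, S.reg (x + 4) = 0) (k₀ : S.arr 0 = a₀) (k₁ : S.arr 1 = a₁)
    (k₂ : S.arr 2 = a₂) (k₃ : S.arr 3 = a₃) (k₄ : S.arr 4 = a₄) (k : ∀ x, S.arr (x + 5) = []) :
    S = mem r₀ r₁ r₂ r₃ a₀ a₁ a₂ a₃ a₄ :=
  State.eq_of (fun x => by rcases x with _ | _ | _ | _ | x <;> simp [*, mem])
    fun l => by rcases l with _ | _ | _ | _ | _ | l <;> simp [*, mem]

theorem exec_mem_call {P : Prog} {w u : List ℕ} {T : ℕ}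
    (h : Exec P (State.init w) T (State.final u)) {i o : ℕ} {S : State} (hi : i < 8) (ho : o < 8)
    (hio : i ≠ o) (hSi : (mem r₀ r₁ r₂ r₃ a₀ a₁ a₂ a₃ a₄).arr i = w)
    (hSo : (mem r₀ r₁ r₂ r₃ a₀ a₁ a₂ a₃ a₄).arr o = [])
    (hS : (⟨(mem r₀ r₁ r₂ r₃ a₀ a₁ a₂ a₃ a₄).reg, Function.update (Function.update
      (mem r₀ r₁ r₂ r₃ a₀ a₁ a₂ a₃ a₄).arr i []) o u⟩ : State) = S) :
    Exec (call P i o) (mem r₀ r₁ r₂ r₃ a₀ a₁ a₂ a₃ a₄) T S :=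
  hS ▸ exec_call h hi ho hio (fun _ => rfl) (fun _ => rfl) hSi hSo

end mem

variable {ι : Type*} {code : ι → List ℕ}

theorem PolyTimeComputable.of_exec {output : ι → List ℕ} {T : ι → ℕ} (P : Prog)
    (hT : PolyBounded code T)
    (h : ∀ a, ∃ s, Exec P (mem 0 0 0 0 (code a) [] [] [] []) (T a) s ∧ s.arr 1 = output a) :
    PolyTimeComputable code output := by
  obtain ⟨p, hp⟩ := hT
  refine ⟨P, p, fun a => ?_⟩
  obtain ⟨s, ⟨t, ht, hr⟩, hs⟩ := h a
  exact ⟨t, s, init_eq_mem _ ▸ hr, ht.trans (hp a), hs⟩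

/-- The second program runs in time polynomial in the size of `mid`, which by `polyBounded` is
itself polynomial in the size of the input. -/
theorem PolyTimeComputable.comp {mid output : ι → List ℕ} (hQ : PolyTimeComputable mid output)
    (hP : PolyTimeComputable code mid) : PolyTimeComputable code output := by
  have hm := hP.polyBounded
  obtain ⟨P, T, hT, hP⟩ := hP.exists_exec
  obtain ⟨Q, T', hT', hQ⟩ := hQ.exists_exec
  refine .of_exec (.seq (call P 0 2) (call Q 2 1))
    (((PolyBounded.const 1).add hT).add (hT'.comp hm)) fun a => ?_
  refine ⟨_, (exec_mem_call (hP a) (by norm_num) (by norm_num) (by norm_num) rfl rfl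
    (mem_ext rfl rfl rfl rfl (fun _ => rfl) rfl rfl rfl rfl rfl fun _ => rfl)).seq
    (exec_mem_call (hQ a) (by norm_num) (by norm_num) (by norm_num) rfl rfl
    (mem_ext rfl rfl rfl rfl (fun _ => rfl) rfl rfl rfl rfl rfl fun _ => rfl)), rfl⟩

/-- Functions of the results of two computations. -/
theorem PolyTimeComputable.binary {f g output : ι → List ℕ} (hf : PolyTimeComputable code f)
    (hg : PolyTimeComputable code g) (Q : Prog) {TQ : ι → ℕ} (hTQ : PolyBounded code TQ)
    (h : ∀ a, ∃ s, Exec Q (mem 0 0 0 0 (code a) [] [] (f a) (g a)) (TQ a) s ∧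
      s.arr 1 = output a) :
    PolyTimeComputable code output := by
  obtain ⟨P, T, hT, hP⟩ := hf.exists_exec
  obtain ⟨P', T', hT', hP'⟩ := hg.exists_exec
  have hc := (PolyBounded.input (code := code)).add (.const 1) |>.copyCost PolyBounded.input
  refine .of_exec (.seq (copy 0 2) (.seq (call P 2 3) (.seq (copy 0 2) (.seq (call P' 2 4) Q))))
    (((PolyBounded.const 1).add hc).add (((PolyBounded.const 1).add hT).add
      (((PolyBounded.const 1).add hc).add (((PolyBounded.const 1).add hT').add hTQ))))
    fun a => ?_
  obtain ⟨s, hs, hs'⟩ := h a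
  refine ⟨s, ((exec_copy (by norm_num) _ rfl rfl le_rfl).of_eq le_rfl
    (mem_ext rfl rfl rfl rfl (fun _ => rfl) rfl rfl rfl rfl rfl fun _ => rfl)).seq
    ((exec_mem_call (hP a) (by norm_num) (by norm_num) (by norm_num) rfl rfl
    (mem_ext rfl rfl rfl rfl (fun _ => rfl) rfl rfl rfl rfl rfl fun _ => rfl)).seq
    (((exec_copy (by norm_num) _ rfl rfl le_rfl).of_eq le_rfl
    (mem_ext rfl rfl rfl rfl (fun _ => rfl) rfl rfl rfl rfl rfl fun _ => rfl)).seq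
    ((exec_mem_call (hP' a) (by norm_num) (by norm_num) (by norm_num) rfl rfl
    (mem_ext rfl rfl rfl rfl (fun _ => rfl) rfl rfl rfl rfl rfl fun _ => rfl)).seq hs))), hs'⟩

theorem PolyTimeComputable.nil : PolyTimeComputable code fun _ => [] :=
  .of_exec .skip (.const 1) fun _ => ⟨_, (Run.skip _).exec, rfl⟩

/-- Computability of a natural number in polynomial time. -/
abbrev PolyTimeNat (code : ι → List ℕ) (f : ι → ℕ) : Prop := PolyTimeComputable code fun a => [f a]

theorem PolyTimeNat.const (c : ℕ) : PolyTimeNat code fun _ => c :=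
  .of_exec (.append 1 (.lit c)) (.const (1 + (c.size + 1))) fun _ =>
    ⟨_, (Run.append _ _ _).exec, rfl⟩

theorem polyTimeNat_length : PolyTimeNat code fun a => (code a).length :=
  .of_exec (.append 1 (.len 0)) ((PolyBounded.const 2).add .input) fun a =>
    ⟨_, (Run.append _ _ _).exec.mono (by
      have := natSize_le_self (code a).length
      have := length_le_size (code a)
      simp [Expr.cost, mem]; omega), rfl⟩

theorem polyTimeComputable_range {b₁ b₂ C : ι → ℕ} (e₁ e₂ : Expr) (hC : PolyBounded code C)
    (he₁ : ∀ a r A, A 0 = code a → e₁.eval ⟨r, A⟩ = b₁ a ∧ e₁.cost ⟨r, A⟩ ≤ C a)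
    (he₂ : ∀ a r A, A 0 = code a → e₂.eval ⟨r, A⟩ = b₂ a ∧ e₂.cost ⟨r, A⟩ ≤ C a)
    (hb : ∀ a, b₁ a ≤ b₂ a) (hb₂ : ∀ a, b₂ a ≤ (code a).length) :
    PolyTimeComputable code fun a => ((code a).drop (b₁ a)).take (b₂ a - b₁ a) :=
  .of_exec (copyRange 0 1 e₁ e₂) (hC.copyCost .input) fun a =>
    ⟨_, exec_copyRange (by norm_num) _ rfl rfl (fun r => he₁ a r _ rfl)
      (fun r => he₂ a r _ rfl) (hb a) (hb₂ a), rfl⟩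

theorem PolyTimeComputable.id : PolyTimeComputable code code := by
  simpa using polyTimeComputable_range (code := code) (b₁ := fun _ => 0)
    (b₂ := fun a => (code a).length) (C := fun a => size (code a) + 1) (.lit 0) (.len 0)
    (PolyBounded.input.add (.const 1)) (fun a r A h => ⟨rfl, by simp [Expr.cost]⟩)
    (fun a r A h => ⟨by simp [Expr.eval, h], by
      have := natSize_le_self (code a).length
      have := length_le_size (code a)
      simp [Expr.cost, h]; omega⟩) (by simp) (by simp)

theorem polyTimeComputable_tail {f : ι → ℕ} :
    PolyTimeComputable (fun a => f a :: code a) code := by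
  simpa using polyTimeComputable_range (code := fun a => f a :: code a) (b₁ := fun _ => 1)
    (b₂ := fun a => (code a).length + 1) (C := fun a => size (f a :: code a) + 2) (.lit 1) (.len 0)
    (PolyBounded.input.add (.const 2)) (fun a r A h => ⟨rfl, by simp [Expr.cost]⟩)
    (fun a r A h => ⟨by simp [Expr.eval, h], by
      have := natSize_le_self ((code a).length + 1)
      have := length_le_size (code a)
      simp [Expr.cost, h]; omega⟩) (by simp) (by simp)

theorem polyTimeComputable_fst {f g : ι → List ℕ} :
    PolyTimeComputable (fun a => encodePair (f a) (g a)) f := by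
  simpa [encodePair] using polyTimeComputable_range (code := fun a => encodePair (f a) (g a))
    (b₁ := fun _ => 1) (b₂ := fun a => 1 + (f a).length)
    (C := fun a => 2 * size (encodePair (f a) (g a)) + 8) (.lit 1)
    (.add (.lit 1) (.get 0 (.lit 0)))
    (((PolyBounded.const 2).mul PolyBounded.input).add (.const 8))
    (fun a r A h => ⟨rfl, by simp [Expr.cost]⟩)
    (fun a r A h => ⟨by simp [Expr.eval, h, encodePair], by
      have := natSize_add_le 1 (f a).length
      simp [Expr.cost, Expr.eval, h, encodePair] at this ⊢; omega⟩) (by simp)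
      (by simp [encodePair]; intro a; omega)

theorem polyTimeComputable_snd {f g : ι → List ℕ} :
    PolyTimeComputable (fun a => encodePair (f a) (g a)) g := by
  have := polyTimeComputable_range (code := fun a => encodePair (f a) (g a))
    (b₁ := fun a => (f a).length + 1) (b₂ := fun a => (f a).length + (g a).length + 1)
    (C := fun a => 2 * size (encodePair (f a) (g a)) + 8) (.add (.get 0 (.lit 0)) (.lit 1))
    (.len 0)
    (((PolyBounded.const 2).mul PolyBounded.input).add (.const 8))
    (fun a r A h => ⟨by simp [Expr.eval, h, encodePair], by
      have := natSize_add_le (f a).length 1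
      simp [Expr.cost, Expr.eval, h, encodePair] at this ⊢; omega⟩)
    (fun a r A h => ⟨by simp [Expr.eval, h, encodePair], by
      have := natSize_le_self ((f a).length + (g a).length + 1)
      have := length_le_size (f a)
      have := length_le_size (g a)
      simp [Expr.cost, h, encodePair]; omega⟩) (fun a => by omega)
      (by simp [encodePair])
  simpa [encodePair, List.take_of_length_le] using this

theorem PolyTimeComputable.append {f g : ι → List ℕ} (hf : PolyTimeComputable code f)
    (hg : PolyTimeComputable code g) : PolyTimeComputable code fun a => f a ++ g a :=
  hf.binary hg (.seq (copy 3 1) (copy 4 1))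
    (((PolyBounded.const 1).add ((hf.polyBounded.add (.const 1)).copyCost hf.polyBounded)).add
      ((hg.polyBounded.add (.const 1)).copyCost hg.polyBounded)) fun a =>
    ⟨_, (exec_copy (by norm_num) _ rfl rfl le_rfl).seq
      (exec_copy (by norm_num) _ rfl rfl le_rfl), rfl⟩

theorem PolyTimeNat.polyBounded {f : ι → ℕ} (hf : PolyTimeNat code f) :
    PolyBounded code fun a => (f a).size :=
  PolyTimeComputable.polyBounded hf |>.mono fun a => by simp

/-- Arithmetic operations preserve computability. -/
theorem PolyTimeNat.op {f g : ι → ℕ} (hf : PolyTimeNat code f) (hg : PolyTimeNat code g)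
    {F : ℕ → ℕ → ℕ} (E : Expr → Expr → Expr)
    (hE : ∀ e e' s, (E e e').eval s = F (e.eval s) (e'.eval s))
    (hEc : ∀ e e' s, (E e e').cost s = ((E e e').eval s).size + 1 + e.cost s + e'.cost s)
    (hF : ∀ x y, (F x y).size ≤ x.size + y.size) : PolyTimeNat code fun a => F (f a) (g a) :=
  PolyTimeComputable.binary hf hg
    (.append 1 (E (.get 3 (.lit 0)) (.get 4 (.lit 0))))
    (((hf.polyBounded.add hg.polyBounded).add (hf.polyBounded.add hg.polyBounded)).add (.const 6))
    fun a => ⟨_, (Run.append _ _ _).exec.mono (by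
      have := hF (f a) (g a)
      simp [hE, hEc, Expr.cost, Expr.eval, mem]; omega), by simp [hE, Expr.eval, mem]⟩

section Arithmetic

variable {f g : ι → ℕ}

theorem PolyTimeNat.add (hf : PolyTimeNat code f) (hg : PolyTimeNat code g) :
    PolyTimeNat code fun a => f a + g a :=
  hf.op hg .add (fun _ _ _ => rfl) (fun _ _ _ => rfl) natSize_add_le

theorem PolyTimeNat.sub (hf : PolyTimeNat code f) (hg : PolyTimeNat code g) :
    PolyTimeNat code fun a => f a - g a :=
  hf.op hg .sub (fun _ _ _ => rfl) (fun _ _ _ => rfl) fun x _ =>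
    (Nat.size_le_size (Nat.sub_le x _)).trans (Nat.le_add_right _ _)

theorem PolyTimeNat.mul (hf : PolyTimeNat code f) (hg : PolyTimeNat code g) :
    PolyTimeNat code fun a => f a * g a :=
  hf.op hg .mul (fun _ _ _ => rfl) (fun _ _ _ => rfl) natSize_mul_le

theorem PolyTimeNat.div (hf : PolyTimeNat code f) (hg : PolyTimeNat code g) :
    PolyTimeNat code fun a => f a / g a :=
  hf.op hg .div (fun _ _ _ => rfl) (fun _ _ _ => rfl) fun x _ =>
    (Nat.size_le_size (Nat.div_le_self x _)).trans (Nat.le_add_right _ _)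

theorem PolyTimeNat.mod (hf : PolyTimeNat code f) (hg : PolyTimeNat code g) :
    PolyTimeNat code fun a => f a % g a :=
  hf.op hg .mod (fun _ _ _ => rfl) (fun _ _ _ => rfl) fun x _ =>
    (Nat.size_le_size (Nat.mod_le x _)).trans (Nat.le_add_right _ _)

end Arithmetic

theorem PolyTimeComputable.getD {w : ι → List ℕ} {i : ι → ℕ} (hw : PolyTimeComputable code w)
    (hi : PolyTimeNat code i) : PolyTimeNat code fun a => (w a).getD (i a) 0 :=
  hw.binary hi (.append 1 (.get 3 (.get 4 (.lit 0))))
    ((hw.polyBounded.add hi.polyBounded).add (.const 4)) fun a =>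
    ⟨_, (Run.append _ _ _).exec.mono (by
      have := size_getD_le (w a) (i a)
      simp [Expr.cost, Expr.eval, mem] at this ⊢; omega), by simp [Expr.eval, mem]⟩


variable {ι : Type*} {code : ι → List ℕ}

/-! ### The Euclidean algorithm -/

/-- The loop of the Euclidean algorithm on registers `2` and `3`. -/
def gcdLoop : Prog :=
  .loop (.reg 2) (.seq (.assign 1 (.mod (.reg 3) (.reg 2)))
    (.seq (.assign 3 (.reg 2)) (.assign 2 (.reg 1))))

/-- For `0 < x ≤ y` one has `2 * (y % x) ≤ y`, so each round at least halves the product of the two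
registers. A product below `2 ^ m` therefore allows at most `m` rounds, a number linear in the bit
length. -/
theorem exec_gcdLoop {a₀ a₁ a₂ a₃ a₄ : List ℕ} (L m : ℕ) : ∀ r x y : ℕ, x ≤ y → y.size ≤ L →
    x * y < 2 ^ m → ∃ r', Exec gcdLoop (mem 0 r x y a₀ a₁ a₂ a₃ a₄) (m * (6 * L + 12) + 2)
      (mem 0 r' 0 (Nat.gcd x y) a₀ a₁ a₂ a₃ a₄) := by
  have halt : ∀ m r y : ℕ, Exec gcdLoop (mem 0 r 0 y a₀ a₁ a₂ a₃ a₄) (m * (6 * L + 12) + 2)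
      (mem 0 r 0 (Nat.gcd 0 y) a₀ a₁ a₂ a₃ a₄) := fun m r y =>
    (Run.loop_stop (by simp [Expr.eval, mem])).exec.of_eq (by simp [Expr.cost, mem])
      (by rw [Nat.gcd_zero_left])
  induction m with
  | zero =>
    intro r x y hxy _ h
    have h0 : x = 0 := by
      have : x * x ≤ x * y := Nat.mul_le_mul_left x hxy
      simp only [pow_zero, Nat.lt_one_iff] at h
      rw [h] at this
      simpa using this
    subst h0
    exact ⟨r, halt 0 r y⟩
  | succ m ih =>
    intro r x y hxy hL h
    rcases Nat.eq_zero_or_pos x with rfl | hx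
    · exact ⟨r, halt _ r y⟩
    have hmod := Nat.mod_lt y hx
    have h2 : 2 * (y % x) ≤ y := by
      have h3 := Nat.mod_add_div y x
      have h4 : x * 1 ≤ x * (y / x) := Nat.mul_le_mul_left x ((Nat.one_le_div_iff hx).2 hxy)
      omega
    obtain ⟨r', hr'⟩ := ih (y % x) (y % x) x hmod.le ((Nat.size_le_size hxy).trans hL) (by
      have : x * (2 * (y % x)) ≤ x * y := Nat.mul_le_mul_left x h2
      rw [pow_succ] at h
      nlinarith)
    refine ⟨r', ?_⟩
    rw [Nat.gcd_rec x y]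
    have hbody := ((Run.assign 1 (.mod (.reg 3) (.reg 2)) (mem 0 r x y a₀ a₁ a₂ a₃ a₄)).exec.seq
      ((Run.assign 3 (.reg 2) _).exec.seq (Run.assign 2 (.reg 1) _).exec)).of_eq le_rfl
      (s'' := mem 0 (y % x) (y % x) x a₀ a₁ a₂ a₃ a₄)
      (mem_ext rfl rfl rfl rfl (fun _ => rfl) rfl rfl rfl rfl rfl fun _ => rfl)
    refine (Exec.loop_step (by simp [Expr.eval, mem]; omega) hbody hr').mono ?_
    have h5 := Nat.size_le_size hxy
    have h6 := Nat.size_le_size hmod.le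
    simp [Expr.cost, Expr.eval, mem, add_mul]
    omega

/-- The loop is started on `f a` and `f a + g a`: this does not change the gcd and provides the
order `x ≤ y` that the halving argument needs. -/
theorem PolyTimeNat.gcd {f g : ι → ℕ} (hf : PolyTimeNat code f) (hg : PolyTimeNat code g) :
    PolyTimeNat code fun a => Nat.gcd (f a) (g a) := by
  have hb := hf.polyBounded.add hg.polyBounded
  refine PolyTimeComputable.binary hf hg
    (.seq (.assign 2 (.get 3 (.lit 0))) (.seq (.assign 3 (.add (.get 3 (.lit 0)) (.get 4 (.lit 0))))
      (.seq gcdLoop (.append 1 (.reg 3)))))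
    ((((hb.add hb).mul (((PolyBounded.const 6).mul hb).add (.const 12))).add
      ((PolyBounded.const 5).mul hb)).add (.const 30)) fun a => ?_
  have hadd := natSize_add_le (f a) (g a)
  obtain ⟨r, hr⟩ := exec_gcdLoop (a₀ := code a) (a₁ := []) (a₂ := []) (a₃ := [f a]) (a₄ := [g a])
    ((f a).size + (g a).size) (((f a).size + (g a).size) + ((f a).size + (g a).size)) 0 (f a)
    (f a + g a) (Nat.le_add_right _ _) hadd (by
      rw [← Nat.size_le]
      exact (natSize_mul_le _ _).trans (by omega))
  refine ⟨_, ((Run.assign _ _ _).exec.of_eq le_rfl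
    (mem_ext rfl rfl rfl rfl (fun _ => rfl) rfl rfl rfl rfl rfl fun _ => rfl)).seq
    (((Run.assign _ _ _).exec.of_eq le_rfl
    (mem_ext rfl rfl rfl rfl (fun _ => rfl) rfl rfl rfl rfl rfl fun _ => rfl)).seq
    (hr.seq (Run.append _ _ _).exec)) |>.mono ?_, ?_⟩
  · have : (Nat.gcd (f a) (f a + g a)).size ≤ (f a).size + (g a).size :=
      (Nat.size_le_size (by
        rcases Nat.eq_zero_or_pos (f a) with h | h
        · simp [h]
        · exact (Nat.gcd_le_left _ h).trans (Nat.le_add_right _ _))).trans hadd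
    simp [Expr.cost, Expr.eval, mem] at this ⊢
    omega
  · simp [mem, Expr.eval]

/-! ### Bounded iteration -/

/-- The loop of `PolyTimeComputable.iterate`: the input is in array `0`, the current value in array
`3`, and registers `2` and `3` hold the number of steps done and to be done. -/
def iterLoop (P : Prog) : Prog :=
  .loop (.sub (.reg 3) (.reg 2)) (.seq (.append 4 (.len 3)) (.seq (copy 3 4)
    (.seq (.append 4 (.reg 2)) (.seq (copy 0 4) (.seq (.clear 3) (.seq (call P 4 3)
      (.assign 2 (.add (.reg 2) (.lit 1)))))))))

/-- Since a call consumes its input, every round assembles in array `4` a fresh copy of the current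
value, the step number and the original input. -/
theorem exec_iterLoop {P : Prog} {w : List ℕ} {st : ℕ → List ℕ} {N T B : ℕ}
    (hP : ∀ j < N, Exec P (State.init (encodePair (st j) (j :: w))) T (State.final (st (j + 1))))
    (hst : ∀ j ≤ N, size (st j) ≤ B) (d : ℕ) : ∀ j, j + d = N →
    Exec (iterLoop P) (mem 0 0 j N w [] [] (st j) [])
      (d * (copyCost (B + 1) B + copyCost (size w + 1) (size w) + T + B + 6 * N + 25) + 2 * N + 5)
      (mem 0 0 N N w [] [] (st N) []) := by
  induction d with
  | zero =>
    rintro j rfl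
    refine (Run.loop_stop (by simp [Expr.eval, mem])).exec.mono ?_
    have := natSize_le_self j
    simp [Expr.cost, Expr.eval, mem]
    omega
  | succ d ih =>
    intro j hj
    have hB := hst j (by omega)
    have h₁ : Exec (.append 4 (.len 3)) (mem 0 0 j N w [] [] (st j) [])
        (1 + ((st j).length.size + 1)) (mem 0 0 j N w [] [] (st j) [(st j).length]) :=
      (Run.append _ _ _).exec.of_eq le_rfl
          (mem_ext rfl rfl rfl rfl (fun _ => rfl) rfl rfl rfl rfl rfl fun _ => rfl)
    have h₂ : Exec (copy 3 4) (mem 0 0 j N w [] [] (st j) [(st j).length])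
        (copyCost (B + 1) B) (mem 0 0 j N w [] [] (st j) ((st j).length :: st j)) :=
      (exec_copy (by norm_num) _ rfl rfl hB).of_eq le_rfl
          (mem_ext rfl rfl rfl rfl (fun _ => rfl) rfl rfl rfl rfl rfl fun _ => rfl)
    have h₃ : Exec (.append 4 (.reg 2)) (mem 0 0 j N w [] [] (st j) ((st j).length :: st j))
        (1 + (j.size + 1)) (mem 0 0 j N w [] [] (st j) (encodePair (st j) [j])) :=
      (Run.append _ _ _).exec.of_eq le_rfl
          (mem_ext rfl rfl rfl rfl (fun _ => rfl) rfl rfl rfl rfl rfl fun _ => rfl)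
    have h₄ : Exec (copy 0 4) (mem 0 0 j N w [] [] (st j) (encodePair (st j) [j]))
        (copyCost (size w + 1) (size w))
        (mem 0 0 j N w [] [] (st j) (encodePair (st j) (j :: w))) :=
      (exec_copy (by norm_num) _ rfl rfl le_rfl).of_eq le_rfl
          (mem_ext rfl rfl rfl rfl (fun _ => rfl) rfl rfl rfl rfl (by simp [mem, encodePair])
            fun _ => rfl)
    have h₅ : Exec (.clear 3) (mem 0 0 j N w [] [] (st j) (encodePair (st j) (j :: w)))
        (1) (mem 0 0 j N w [] [] [] (encodePair (st j) (j :: w))) :=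
      (Run.clear _ _).exec.of_eq le_rfl
          (mem_ext rfl rfl rfl rfl (fun _ => rfl) rfl rfl rfl rfl rfl fun _ => rfl)
    have h₆ : Exec (call P 4 3) (mem 0 0 j N w [] [] [] (encodePair (st j) (j :: w)))
        (T) (mem 0 0 j N w [] [] (st (j + 1)) []) :=
      exec_mem_call (hP j (by omega)) (by norm_num) (by norm_num) (by norm_num) rfl rfl
          (mem_ext rfl rfl rfl rfl (fun _ => rfl) rfl rfl rfl rfl rfl fun _ => rfl)
    have h₇ : Exec (.assign 2 (.add (.reg 2) (.lit 1))) (mem 0 0 j N w [] [] (st (j + 1)) [])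
        (1 + ((j + 1).size + 1 + (j.size + 1) + (Nat.size 1 + 1)))
        (mem 0 0 (j + 1) N w [] [] (st (j + 1)) []) :=
      (Run.assign _ _ _).exec.of_eq le_rfl
          (mem_ext rfl rfl rfl rfl (fun _ => rfl) rfl rfl rfl rfl rfl fun _ => rfl)
    have hbody := h₁.seq (h₂.seq (h₃.seq (h₄.seq (h₅.seq (h₆.seq h₇)))))
    refine (Exec.loop_step (by simp [Expr.eval, mem]; omega) hbody (ih (j + 1) (by omega))).mono ?_
    have h1 := natSize_le_self j
    have h2 := natSize_le_self N
    have h3 := natSize_le_self (N - j)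
    have h4 := natSize_le_self (j + 1)
    have h5 := (natSize_le_self (st j).length).trans ((length_le_size _).trans hB)
    simp only [Expr.cost, Expr.eval, mem, add_mul, one_mul, Nat.size_one]
    omega

/-- Iteration of a computable step, with a polynomial number of steps and values of polynomial
size. -/
theorem PolyTimeComputable.iterate {N B : ι → ℕ} {st : ι → ℕ → List ℕ} (hN : PolyTimeNat code N)
    (hNB : PolyBounded code N) (hB : PolyBounded code B)
    (hst : ∀ a, ∀ j ≤ N a, size (st a j) ≤ B a)
    (hinit : PolyTimeComputable code fun a => st a 0)
    (hstep : PolyTimeComputable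
      (fun p : {p : ι × ℕ // p.2 < N p.1} => encodePair (st p.1.1 p.1.2) (p.1.2 :: code p.1.1))
      fun p => st p.1.1 (p.1.2 + 1)) :
    PolyTimeComputable code fun a => st a (N a) := by
  obtain ⟨Pn, Tn, hTn, hPn⟩ := hN.exists_exec
  obtain ⟨Pi, Ti, hTi, hPi⟩ := hinit.exists_exec
  obtain ⟨Ps, Ts, hTs, hPs⟩ := hstep.exists_exec
  obtain ⟨q, hq⟩ : PolyBounded (fun p : {p : ι × ℕ // p.2 < N p.1} => code p.1.1) Ts := by
    refine hTs.comp ((((((hB.add hB).add hNB).add .input).add (.const 2)).restrict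
      (fun p : {p : ι × ℕ // p.2 < N p.1} => p.1.1)).mono fun p => ?_)
    have h1 := hst p.1.1 p.1.2 p.2.le
    have h2 := (natSize_le_self _).trans ((length_le_size (st p.1.1 p.1.2)).trans h1)
    have h3 := (natSize_le_self p.1.2).trans p.2.le
    simp only [encodePair, size_cons, size_append]
    omega
  have hc := (PolyBounded.input (code := code)).add (.const 1) |>.copyCost PolyBounded.input
  have hcB := (hB.add (.const 1)).copyCost hB
  refine .of_exec (.seq (copy 0 4) (.seq (call Pn 4 3) (.seq (.assign 3 (.get 3 (.lit 0)))
    (.seq (.clear 3) (.seq (copy 0 4) (.seq (call Pi 4 3) (.seq (iterLoop Ps) (copy 3 1))))))))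
    (T := fun a => 2 * copyCost (size (code a) + 1) (size (code a)) + Tn a + N a + Ti a +
      (N a * (copyCost (B a + 1) (B a) + copyCost (size (code a) + 1) (size (code a)) +
        q.eval (size (code a)) + B a + 6 * N a + 25) + 2 * N a + 5) + copyCost (B a + 1) (B a) + 20)
    ((((((((((PolyBounded.const 2).mul hc).add hTn).add hNB).add hTi).add
      (((hNB.mul (((((hcB.add hc).add (PolyBounded.input.eval q)).add hB).add
        ((PolyBounded.const 6).mul hNB)).add (.const 25))).add
        ((PolyBounded.const 2).mul hNB)).add (.const 5))).add hcB).add (.const 20))))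
    fun a => ?_
  have hloop := exec_iterLoop (P := Ps) (w := code a) (st := st a) (N := N a)
    (T := q.eval (size (code a))) (B := B a)
    (fun j hj => (hPs ⟨(a, j), hj⟩).mono (hq ⟨(a, j), hj⟩)) (hst a) (N a) 0 (zero_add _)
  have h₁ : Exec (copy 0 4) (mem 0 0 0 0 (code a) [] [] [] [])
      (copyCost (size (code a) + 1) (size (code a))) (mem 0 0 0 0 (code a) [] [] [] (code a)) :=
    (exec_copy (by norm_num) _ rfl rfl le_rfl).of_eq le_rfl
        (mem_ext rfl rfl rfl rfl (fun _ => rfl) rfl rfl rfl rfl rfl fun _ => rfl)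
  have h₂ : Exec (call Pn 4 3) (mem 0 0 0 0 (code a) [] [] [] (code a))
      (Tn a) (mem 0 0 0 0 (code a) [] [] [N a] []) :=
    exec_mem_call (hPn a) (by norm_num) (by norm_num) (by norm_num) rfl rfl
        (mem_ext rfl rfl rfl rfl (fun _ => rfl) rfl rfl rfl rfl rfl fun _ => rfl)
  have h₃ : Exec (.assign 3 (.get 3 (.lit 0))) (mem 0 0 0 0 (code a) [] [] [N a] [])
      (1 + ((N a).size + 1 + (Nat.size 0 + 1))) (mem 0 0 0 (N a) (code a) [] [] [N a] []) :=
    (Run.assign _ _ _).exec.of_eq le_rfl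
        (mem_ext rfl rfl rfl rfl (fun _ => rfl) rfl rfl rfl rfl rfl fun _ => rfl)
  have h₄ : Exec (.clear 3) (mem 0 0 0 (N a) (code a) [] [] [N a] [])
      (1) (mem 0 0 0 (N a) (code a) [] [] [] []) :=
    (Run.clear _ _).exec.of_eq le_rfl
        (mem_ext rfl rfl rfl rfl (fun _ => rfl) rfl rfl rfl rfl rfl fun _ => rfl)
  have h₅ : Exec (copy 0 4) (mem 0 0 0 (N a) (code a) [] [] [] [])
      (copyCost (size (code a) + 1) (size (code a))) (mem 0 0 0 (N a) (code a) [] [] [] (code a)) :=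
    (exec_copy (by norm_num) _ rfl rfl le_rfl).of_eq le_rfl
        (mem_ext rfl rfl rfl rfl (fun _ => rfl) rfl rfl rfl rfl rfl fun _ => rfl)
  have h₆ : Exec (call Pi 4 3) (mem 0 0 0 (N a) (code a) [] [] [] (code a))
      (Ti a) (mem 0 0 0 (N a) (code a) [] [] (st a 0) []) :=
    exec_mem_call (hPi a) (by norm_num) (by norm_num) (by norm_num) rfl rfl
        (mem_ext rfl rfl rfl rfl (fun _ => rfl) rfl rfl rfl rfl rfl fun _ => rfl)
  have h₇ : Exec (copy 3 1) (mem 0 0 (N a) (N a) (code a) [] [] (st a (N a)) [])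
      (copyCost (B a + 1) (B a)) (mem 0 0 (N a) (N a) (code a) (st a (N a)) [] (st a (N a)) []) :=
    (exec_copy (by norm_num) _ rfl rfl (hst a (N a) le_rfl)).of_eq le_rfl
        (mem_ext rfl rfl rfl rfl (fun _ => rfl) rfl rfl rfl rfl rfl fun _ => rfl)
  refine ⟨_, (h₁.seq (h₂.seq (h₃.seq (h₄.seq (h₅.seq (h₆.seq (hloop.seq h₇))))))).mono ?_, rfl⟩
  have := natSize_le_self (N a)
  simp only [Nat.size_zero]
  omega


variable {ι κ : Type*} {code : ι → List ℕ}

/-! ### Loops over an index range -/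

theorem PolyTimeComputable.restrict {f : ι → List ℕ} (hf : PolyTimeComputable code f) (g : κ → ι) :
    PolyTimeComputable (fun b => code (g b)) fun b => f (g b) :=
  let ⟨P, p, h⟩ := hf
  ⟨P, p, fun b => h (g b)⟩

/-- Extend the input by a number. -/
def push (code : ι → List ℕ) (p : ι × ℕ) : List ℕ := p.2 :: code p.1

theorem PolyTimeComputable.lift {f : ι → List ℕ} (hf : PolyTimeComputable code f) :
    PolyTimeComputable (push code) fun p => f p.1 :=
  (hf.restrict Prod.fst).comp polyTimeComputable_tail

theorem PolyTimeNat.lift {f : ι → ℕ} (hf : PolyTimeNat code f) :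
    PolyTimeNat (push code) fun p => f p.1 :=
  PolyTimeComputable.lift hf

theorem PolyTimeNat.of_eq {f g : ι → ℕ} (hf : PolyTimeNat code f) (h : ∀ a, g a = f a) :
    PolyTimeNat code g :=
  funext h ▸ hf

theorem PolyTimeNat.var : PolyTimeNat (push code) Prod.snd := by
  simpa [push] using (PolyTimeComputable.id (code := push code)).getD (.const 0)

theorem PolyBounded.lift {X : ι → ℕ} (hX : PolyBounded code X) :
    PolyBounded (push code) fun p => X p.1 := by
  obtain ⟨p, hp⟩ := hX
  exact ⟨p, fun a => (hp a.1).trans (eval_mono p (by simp [push]))⟩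

/-- Turns a bound in terms of the input extended by a loop index into one bound that is valid for
all rounds at once. -/
theorem PolyBounded.exists_of_lt {X : ι × ℕ → ℕ} {N : ι → ℕ} (hX : PolyBounded (push code) X)
    (hN : PolyBounded code N) :
    ∃ B, PolyBounded code B ∧ ∀ a, ∀ j < N a, X (a, j) ≤ B a := by
  obtain ⟨p, hp⟩ := hX
  refine ⟨fun a => p.eval (N a + 1 + size (code a)), ((hN.add (.const 1)).add .input).eval p,
    fun a j hj => (hp (a, j)).trans (eval_mono p ?_)⟩
  have := natSize_le_self j
  simp only [push, size_cons]
  omega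

theorem PolyTimeComputable.flatMap {N : ι → ℕ} {f : ι → ℕ → List ℕ} (hN : PolyTimeNat code N)
    (hNB : PolyBounded code N) (hf : PolyTimeComputable (push code) fun p => f p.1 p.2) :
    PolyTimeComputable code fun a => (List.range (N a)).flatMap (f a) := by
  obtain ⟨B, hB, hfB⟩ := hf.polyBounded.exists_of_lt hNB
  refine PolyTimeComputable.iterate (st := fun a j => (List.range j).flatMap (f a)) hN hNB
    (hNB.mul hB) (fun a j hj => ?_) .nil ?_
  · have key : ∀ j ≤ N a, size ((List.range j).flatMap (f a)) ≤ j * B a := by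
      intro j
      induction j with
      | zero => simp
      | succ j ih =>
        intro hj
        have h1 := ih (by omega)
        have h2 := hfB a j hj
        simp only [List.range_succ, List.flatMap_append, List.flatMap_singleton, size_append,
          add_mul, one_mul] at h2 ⊢
        omega
    exact (key j hj).trans (Nat.mul_le_mul_right _ hj)
  · have h := polyTimeComputable_fst (ι := {p : ι × ℕ // p.2 < N p.1})
      (f := fun p => (List.range p.1.2).flatMap (f p.1.1)) (g := fun p => push code p.1) |>.append
      ((hf.restrict fun p : {p : ι × ℕ // p.2 < N p.1} => p.1).comp polyTimeComputable_snd)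
    simpa [List.range_succ, push] using h

/-- Iteration with an accumulator. -/
theorem PolyTimeNat.fold {N : ι → ℕ} {f : ι → ℕ → ℕ} {acc : ι → ℕ → ℕ} {F : ℕ → ℕ → ℕ} {c : ℕ}
    (hN : PolyTimeNat code N) (hNB : PolyBounded code N)
    (hf : PolyTimeNat (push code) fun p => f p.1 p.2) (h0 : ∀ a, acc a 0 = c)
    (hacc : ∀ a j, acc a (j + 1) = F (acc a j) (f a j))
    (hFs : ∀ x y, (F x y).size ≤ x.size + y.size)
    (hF : ∀ {code : {p : ι × ℕ // p.2 < N p.1} → List ℕ} {f g : {p : ι × ℕ // p.2 < N p.1} → ℕ},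
      PolyTimeNat code f → PolyTimeNat code g → PolyTimeNat code fun a => F (f a) (g a)) :
    PolyTimeNat code fun a => acc a (N a) := by
  obtain ⟨B, hB, hfB⟩ := hf.polyBounded.exists_of_lt hNB
  refine PolyTimeComputable.iterate (st := fun a j => [acc a j]) hN hNB
    ((hNB.mul hB).add (.const (c.size + 1))) (fun a j hj => ?_)
    (by simpa only [h0] using PolyTimeNat.const c) ?_
  -- Binary length is subadditive under `F`, so the accumulator gains at most `B a` bits per round.
  -- This covers products as well as sums.
  · have key : ∀ j ≤ N a, (acc a j).size ≤ j * B a + c.size := by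
      intro j
      induction j with
      | zero => simp [h0]
      | succ j ih =>
        intro hj
        have h1 := ih (by omega)
        have h2 := hfB a j hj
        have h3 := hFs (acc a j) (f a j)
        rw [hacc, add_mul, one_mul]
        dsimp only at h2
        omega
    have h1 := key j hj
    have h2 := Nat.mul_le_mul_right (B a) hj
    simp only [size_cons, size_nil]
    omega
  · simp only [hacc]
    refine hF ?_ ((hf.restrict fun p : {p : ι × ℕ // p.2 < N p.1} => p.1).comp
      polyTimeComputable_snd)
    exact polyTimeComputable_fst

theorem PolyTimeNat.sum {N : ι → ℕ} {f : ι → ℕ → ℕ} (hN : PolyTimeNat code N)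
    (hNB : PolyBounded code N) (hf : PolyTimeNat (push code) fun p => f p.1 p.2) :
    PolyTimeNat code fun a => ∑ j ∈ Finset.range (N a), f a j :=
  PolyTimeNat.fold (acc := fun a j => ∑ l ∈ Finset.range j, f a l) hN hNB hf (fun _ => rfl)
    (fun a j => Finset.sum_range_succ (f a) j) natSize_add_le .add

theorem PolyTimeNat.prod {N : ι → ℕ} {f : ι → ℕ → ℕ} (hN : PolyTimeNat code N)
    (hNB : PolyBounded code N) (hf : PolyTimeNat (push code) fun p => f p.1 p.2) :
    PolyTimeNat code fun a => ∏ j ∈ Finset.range (N a), f a j :=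
  PolyTimeNat.fold (acc := fun a j => ∏ l ∈ Finset.range j, f a l) hN hNB hf (fun _ => rfl)
    (fun a j => Finset.prod_range_succ (f a) j) natSize_mul_le .mul

/-- `hfB` bounds the value of `f` and not merely its bit length: the factorial is a product of `f a`
factors, found in `f a` rounds. -/
theorem PolyTimeNat.factorial {f : ι → ℕ} (hf : PolyTimeNat code f) (hfB : PolyBounded code f) :
    PolyTimeNat code fun a => (f a).factorial := by
  simpa only [Finset.prod_range_add_one_eq_factorial] using
    PolyTimeNat.prod (f := fun _ j => j + 1) hf hfB (PolyTimeNat.var.add (.const 1))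

theorem PolyTimeNat.choose {f g : ι → ℕ} (hf : PolyTimeNat code f) (hfB : PolyBounded code f)
    (hg : PolyTimeNat code g) (hgf : ∀ a, g a ≤ f a) :
    PolyTimeNat code fun a => (f a).choose (g a) := by
  simp only [fun a => Nat.choose_eq_factorial_div_factorial (hgf a)]
  exact (hf.factorial hfB).div ((hg.factorial (hfB.mono hgf)).mul
    ((hf.sub hg).factorial (hfB.mono fun a => Nat.sub_le _ _)))

/-! ### Decidability in polynomial time -/

/-- The predicate `P` is decidable in polynomial time. -/
def PolyTimePred (code : ι → List ℕ) (P : ι → Prop) : Prop :=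
  ∃ f, PolyTimeNat code f ∧ ∀ a, P a ↔ f a ≠ 0

namespace PolyTimePred

variable {P Q : ι → Prop}

theorem of_iff (hP : PolyTimePred code P) (h : ∀ a, Q a ↔ P a) : PolyTimePred code Q :=
  let ⟨f, hf, hfP⟩ := hP
  ⟨f, hf, fun a => (h a).trans (hfP a)⟩

theorem lt {f g : ι → ℕ} (hf : PolyTimeNat code f) (hg : PolyTimeNat code g) :
    PolyTimePred code fun a => f a < g a :=
  ⟨_, hg.sub hf, fun a => by omega⟩

theorem not (hP : PolyTimePred code P) : PolyTimePred code fun a => ¬ P a := by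
  obtain ⟨f, hf, hfP⟩ := hP
  exact ⟨_, (PolyTimeNat.const 1).sub hf, fun a => (hfP a).not.trans (by omega)⟩

theorem and (hP : PolyTimePred code P) (hQ : PolyTimePred code Q) :
    PolyTimePred code fun a => P a ∧ Q a := by
  obtain ⟨f, hf, hfP⟩ := hP
  obtain ⟨g, hg, hgQ⟩ := hQ
  exact ⟨_, hf.mul hg, fun a => ((hfP a).and (hgQ a)).trans mul_ne_zero_iff.symm⟩

theorem or (hP : PolyTimePred code P) (hQ : PolyTimePred code Q) :
    PolyTimePred code fun a => P a ∨ Q a :=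
  (hP.not.and hQ.not).not.of_iff fun a => by tauto

theorem imp (hP : PolyTimePred code P) (hQ : PolyTimePred code Q) :
    PolyTimePred code fun a => P a → Q a :=
  (hP.not.or hQ).of_iff fun a => by tauto

theorem eq {f g : ι → ℕ} (hf : PolyTimeNat code f) (hg : PolyTimeNat code g) :
    PolyTimePred code fun a => f a = g a :=
  ((lt hf hg).or (lt hg hf)).not.of_iff fun a => by omega

theorem forall_lt {N : ι → ℕ} {P : ι → ℕ → Prop} (hN : PolyTimeNat code N)
    (hNB : PolyBounded code N) (hP : PolyTimePred (push code) fun p => P p.1 p.2) :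
    PolyTimePred code fun a => ∀ j < N a, P a j := by
  obtain ⟨f, hf, hfP⟩ := hP
  refine ⟨_, hN.prod (f := fun a j => f (a, j)) hNB hf, fun a => ?_⟩
  simp [Finset.prod_ne_zero_iff, fun j => hfP (a, j)]

theorem indicator (hP : PolyTimePred code P) [DecidablePred P] :
    PolyTimeNat code fun a => if P a then 1 else 0 := by
  obtain ⟨f, hf, hfP⟩ := hP
  convert (PolyTimeNat.const 1).sub ((PolyTimeNat.const 1).sub hf) using 3 with a
  split_ifs with h
  · have := (hfP a).1 h; omega
  · have := (hfP a).not.1 h; omega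

theorem card_range {N : ι → ℕ} {P : ι → ℕ → Prop} [∀ a, DecidablePred (P a)]
    (hN : PolyTimeNat code N) (hNB : PolyBounded code N)
    (hP : PolyTimePred (push code) fun p => P p.1 p.2) :
    PolyTimeNat code fun a => ((Finset.range (N a)).filter (P a)).card := by
  classical
  simp only [Finset.card_filter]
  refine hN.sum hNB ?_
  convert hP.indicator using 3

end PolyTimePred

end BitCost

/-! ### Counting coalitions by their profile -/

section Profile

open Finset

variable {n : ℕ} (rep : ℕ → ℕ) (i : ℕ)

/-- The players other than `i` with label `r`. -/
def labelClass (n : ℕ) (rep : ℕ → ℕ) (i r : ℕ) : Finset (Fin n) :=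
  univ.filter fun j => (j : ℕ) ≠ i ∧ rep j = r

/-- The number of profiles of coalitions without the player `i`. -/
def numProfiles (n : ℕ) (rep : ℕ → ℕ) (i m : ℕ) : ℕ :=
  ∏ r ∈ range m, ((labelClass n rep i r).card + 1)

/-- The number of players with label `r` in profile number `c`. -/
def profileDigit (n : ℕ) (rep : ℕ → ℕ) (i c r : ℕ) : ℕ :=
  c / numProfiles n rep i r % ((labelClass n rep i r).card + 1)

/-- The number of players other than `i` with the same label as `j` that precede `j`. -/
def labelRank (n : ℕ) (rep : ℕ → ℕ) (i j : ℕ) : ℕ :=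
  ((labelClass n rep i (rep j)).filter fun l : Fin n => (l : ℕ) < j).card

/-- A coalition without the player `i` that has profile number `c`. -/
def profileCoalition (n : ℕ) (rep : ℕ → ℕ) (i c : ℕ) : Finset (Fin n) :=
  univ.filter fun j => (j : ℕ) ≠ i ∧ labelRank n rep i j < profileDigit n rep i c (rep j)

/-- The number of coalitions without the player `i` that have profile number `c`. -/
def profileMultiplicity (n : ℕ) (rep : ℕ → ℕ) (i c : ℕ) : ℕ :=
  ∏ r ∈ range n, (labelClass n rep i r).card.choose (profileDigit n rep i c r)

/-- The coalition `profileCoalition`, joined by the player `i`. -/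
def joinedCoalition (n : ℕ) (rep : ℕ → ℕ) (i c : ℕ) : Finset (Fin n) :=
  univ.filter fun j => (j : ℕ) = i ∨
    ((j : ℕ) ≠ i ∧ labelRank n rep i j < profileDigit n rep i c (rep j))

/-- The total weight in the raw Shapley value of the coalitions that have profile number `c`. -/
def profileWeight (n : ℕ) (rep : ℕ → ℕ) (i c : ℕ) : ℕ :=
  profileMultiplicity n rep i c * (profileCoalition n rep i c).card.factorial *
    (n - (profileCoalition n rep i c).card - 1).factorial

theorem profileDigit_le (c r : ℕ) :
    profileDigit n rep i c r ≤ (labelClass n rep i r).card :=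
  Nat.lt_succ_iff.1 (Nat.mod_lt _ (Nat.succ_pos _))

/-- The rank inside `A` is strictly monotone, hence a bijection of `A` onto `range A.card`. This
makes "the first `p` members of each class" a coalition with prescribed class counts. -/
theorem card_filter_rank_lt {α : Type*} [LinearOrder α] (A : Finset α) {p : ℕ} (hp : p ≤ A.card) :
    (A.filter fun j => (A.filter (· < j)).card < p).card = p := by
  have hmono : ∀ x ∈ A, ∀ y ∈ A, x < y → (A.filter (· < x)).card < (A.filter (· < y)).card := by
    intro x hx y hy hxy
    refine card_lt_card ((ssubset_iff_of_subset fun z hz => ?_).2 ⟨x, by simp [hx, hxy], by simp⟩)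
    simp only [mem_filter] at hz ⊢
    exact ⟨hz.1, hz.2.trans hxy⟩
  have hinj : Set.InjOn (fun j => (A.filter (· < j)).card) (A : Set α) := by
    intro x hx y hy hxy
    rcases lt_trichotomy x y with h | h | h
    · exact absurd hxy (hmono x hx y hy h).ne
    · exact h
    · exact absurd hxy (hmono y hy x hx h).ne'
  have himage : A.image (fun j => (A.filter (· < j)).card) = range A.card := by
    refine eq_of_subset_of_card_le (fun x hx => ?_) (by rw [card_image_of_injOn hinj, card_range])
    obtain ⟨y, hy, rfl⟩ := mem_image.1 hx
    exact mem_range.2 (card_lt_card (filter_ssubset.2 ⟨y, hy, lt_irrefl y⟩))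
  rw [← card_image_of_injOn (hinj.mono (coe_subset.2 (filter_subset _ _))),
    show (A.filter fun j => (A.filter (· < j)).card < p).image (fun j => (A.filter (· < j)).card) =
      range p from ?_, card_range]
  ext x
  constructor
  · intro hx
    obtain ⟨y, hy, rfl⟩ := mem_image.1 hx
    exact mem_range.2 (mem_filter.1 hy).2
  · intro hx
    have hx' : x ∈ A.image (fun j => (A.filter (· < j)).card) := by
      rw [himage]
      exact mem_range.2 ((mem_range.1 hx).trans_le hp)
    obtain ⟨y, hy, rfl⟩ := mem_image.1 hx'
    exact mem_image.2 ⟨y, mem_filter.2 ⟨hy, mem_range.1 hx⟩, rfl⟩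

theorem card_profileCoalition (c r : ℕ) :
    ((profileCoalition n rep i c).filter fun j : Fin n => rep j = r).card =
      profileDigit n rep i c r := by
  refine Eq.trans ?_ (card_filter_rank_lt (labelClass n rep i r) (profileDigit_le rep i c r))
  congr 1
  ext j
  simp only [profileCoalition, labelRank, mem_filter, mem_univ, true_and, Fin.val_fin_lt]
  constructor
  · rintro ⟨⟨h1, h2⟩, rfl⟩
    exact ⟨by simp [labelClass, h1], h2⟩
  · rintro ⟨h1, h2⟩
    simp only [labelClass, mem_filter, mem_univ, true_and] at h1
    obtain ⟨h1, rfl⟩ := h1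
    exact ⟨⟨h1, h2⟩, rfl⟩

variable {rep i}

/-- A coalition is the same thing as an independent choice of its intersection with each label
class. `hrep` ensures that the label of every player is among the indices `r : Fin n`. -/
theorem card_filter_profile (hrep : ∀ j < n, rep j < n) (i : Fin n) (p : Fin n → ℕ) :
    (((univ.erase i).powerset).filter fun S : Finset (Fin n) =>
      ∀ r : Fin n, (S.filter fun j : Fin n => rep j = r).card = p r).card =
    ∏ r : Fin n, (labelClass n rep i r).card.choose (p r) := by
  simp only [← card_powersetCard]
  rw [← Fintype.card_piFinset]
  refine card_nbij' (fun S r => S.filter fun j : Fin n => rep j = r)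
    (fun f => univ.filter fun j => j ∈ f ⟨rep j, hrep j j.2⟩) ?_ ?_ ?_ ?_
  · intro S hS
    simp only [coe_filter, Set.mem_ofPred_eq, mem_powerset] at hS
    simp only [mem_coe, Fintype.mem_piFinset, mem_powersetCard]
    refine fun r => ⟨fun j hj => ?_, hS.2 r⟩
    simp only [mem_filter] at hj
    have := (mem_erase.1 (hS.1 hj.1)).1
    simp [labelClass, hj.2, Fin.val_inj, this]
  · intro f hf
    simp only [mem_coe, Fintype.mem_piFinset, mem_powersetCard] at hf
    have hfr : ∀ r j, j ∈ f r → j ≠ i ∧ rep j = r := fun r j hj => by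
      simpa [labelClass, Fin.val_inj] using (hf r).1 hj
    simp only [coe_filter, Set.mem_ofPred_eq, mem_powerset]
    refine ⟨fun j hj => by simpa using (hfr _ j (mem_filter.1 hj).2).1, fun r => ?_⟩
    rw [← (hf r).2]
    congr 1
    ext j
    simp only [mem_filter, mem_univ, true_and]
    constructor
    · rintro ⟨h1, h2⟩
      convert h1
      exact h2.symm
    · intro h
      have h2 := (hfr r j h).2
      refine ⟨?_, h2⟩
      convert h
  · intro S hS
    ext j
    simp
  · intro f hf
    simp only [mem_coe, Fintype.mem_piFinset, mem_powersetCard] at hf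
    funext r
    ext j
    simp only [mem_filter, mem_univ, true_and]
    have hfr : j ∈ f r → rep j = r := fun hj => by
      have := (hf r).1 hj
      simp only [labelClass, mem_filter] at this
      exact this.2.2
    constructor
    · rintro ⟨h1, h2⟩
      convert h1
      exact h2.symm
    · intro h
      refine ⟨?_, hfr h⟩
      convert h
      exact hfr h

/-- Profiles are tuples of digits bounded by the class sizes, and `finPiFinEquiv` numbers them in
mixed radix. Grouping coalitions by profile number gives fibres on which `F` is constant and whose
sizes are given by `card_filter_profile`. -/
theorem sum_powerset_eq_sum_profiles {R : Type*} [CommSemiring R] (hrep : ∀ j < n, rep j < n)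
    (i : Fin n) (F : Finset (Fin n) → R)
    (hF : ∀ S T : Finset (Fin n), i ∉ S → i ∉ T →
      (∀ r, (S.filter fun j : Fin n => rep j = r).card =
        (T.filter fun j : Fin n => rep j = r).card) →
        F S = F T) :
    ∑ S ∈ (univ.erase i).powerset, F S =
      ∑ c ∈ range (numProfiles n rep i n),
        (profileMultiplicity n rep i c : R) * F (profileCoalition n rep i c) := by
  have hprod : ∏ r : Fin n, ((labelClass n rep i r).card + 1) = numProfiles n rep i n :=
    Fin.prod_univ_eq_prod_range (fun r => (labelClass n rep i r).card + 1) n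
  have hlt : ∀ S ∈ (univ.erase i).powerset, ∀ r : Fin n,
      (S.filter fun j : Fin n => rep j = r).card < (labelClass n rep i r).card + 1 := by
    intro S hS r
    refine Nat.lt_succ_iff.2 (card_le_card fun j hj => ?_)
    simp only [mem_filter] at hj
    have := (mem_erase.1 (mem_powerset.1 hS hj.1)).1
    simp [labelClass, hj.2, Fin.val_inj, this]
  let e := finPiFinEquiv (m := n) (n := fun r => (labelClass n rep i r).card + 1)
  -- The place value of digit `r` is the product of the preceding radices, that is, `numProfiles`
  -- truncated at `r`.
  have he : ∀ c r, ((e.symm c r : Fin _) : ℕ) = profileDigit n rep i c r := by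
    intro c r
    have : ∏ j : Fin r, ((labelClass n rep i (Fin.castLE r.is_lt.le j)).card + 1) =
        numProfiles n rep i r :=
      Fin.prod_univ_eq_prod_range (fun r => (labelClass n rep i r).card + 1) r
    rw [profileDigit, ← this]
    rfl
  -- The profile number of `S`. The default `0` is never consulted, as the fibres are taken inside
  -- the powerset.
  let g : Finset (Fin n) → ℕ := fun S =>
    if hS : S ∈ (univ.erase i).powerset then e fun r => ⟨_, hlt S hS r⟩ else 0
  have hg : ∀ S ∈ (univ.erase i).powerset, g S ∈ range (numProfiles n rep i n) := by
    intro S hS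
    simp only [g, dif_pos hS, mem_range, ← hprod]
    exact Fin.is_lt _
  rw [← sum_fiberwise_of_maps_to hg]
  refine sum_congr rfl fun c hc => ?_
  have hc' : c < ∏ r : Fin n, ((labelClass n rep i r).card + 1) := by
    rw [hprod]; exact mem_range.1 hc
  have hmem : ∀ S ∈ (univ.erase i).powerset, g S = c ↔
      ∀ r : Fin n, (S.filter fun j : Fin n => rep j = r).card =
      profileDigit n rep i c r := by
    intro S hS
    have h1 : g S = c ↔ (fun r => ⟨_, hlt S hS r⟩) = e.symm ⟨c, hc'⟩ := by
      simp only [g, dif_pos hS]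
      rw [Equiv.eq_symm_apply, Fin.ext_iff]
    rw [h1, funext_iff]
    exact forall_congr' fun r => by rw [Fin.ext_iff, he]
  rw [filter_congr hmem, sum_congr rfl (g := fun _ => F (profileCoalition n rep i c)), sum_const,
    card_filter_profile hrep, nsmul_eq_mul, profileMultiplicity,
    Fin.prod_univ_eq_prod_range
      (fun r => (labelClass n rep i r).card.choose (profileDigit n rep i c r)) n]
  intro S hS
  simp only [mem_filter, mem_powerset] at hS
  refine hF S _ (fun h => by simpa using hS.1 h) (by simp [profileCoalition]) fun r => ?_
  rw [card_profileCoalition]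
  by_cases hr : r < n
  · exact hS.2 ⟨r, hr⟩
  -- No player has a label `r ≥ n`, so both counts vanish.
  · have h0 : labelClass n rep i r = ∅ := by
      ext j
      have := hrep j j.2
      simp [labelClass]
      omega
    have h1 := profileDigit_le (n := n) rep i c r
    rw [h0, card_empty] at h1
    rw [Nat.le_zero.1 h1, card_eq_zero, filter_eq_empty_iff]
    intro j _
    have := hrep j j.2
    omega

/-- The Shapley summand depends only on the profile: the cardinality is the sum of the class counts,
and inserting `i` raises the count of the same class in any two coalitions without `i`. -/
theorem rawShapley_eq_sum_profiles (hrep : ∀ j < n, rep j < n) (v : CoopGame (Fin n))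
    (hv : ∀ S T : Finset (Fin n), (∀ r, (S.filter fun j : Fin n => rep j = r).card =
      (T.filter fun j : Fin n => rep j = r).card) → v S = v T) (i : Fin n) :
    v.rawShapley i = ∑ c ∈ range (numProfiles n rep i n),
      (profileWeight n rep i c : ℚ) *
        (v (joinedCoalition n rep i c) - v (profileCoalition n rep i c)) := by
  have hcard : ∀ S : Finset (Fin n), S.card =
      ∑ r ∈ range n, (S.filter fun j : Fin n => rep j = r).card := fun S =>
    card_eq_sum_card_fiberwise fun j _ => mem_coe.2 (mem_range.2 (hrep j j.2))
  rw [CoopGame.rawShapley, sum_powerset_eq_sum_profiles hrep i]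
  · refine sum_congr rfl fun c _ => ?_
    have : joinedCoalition n rep i c = insert i (profileCoalition n rep i c) := by
      ext j; simp [joinedCoalition, profileCoalition, Fin.val_inj]
    rw [this, Fintype.card_fin, profileWeight]
    push_cast
    ring
  · intro S T hS hT h
    have h1 : S.card = T.card := by
      rw [hcard S, hcard T]
      exact sum_congr rfl fun r _ => h r
    rw [h1, hv S T h, hv (insert i S) (insert i T) fun r => ?_]
    rw [filter_insert, filter_insert]
    split_ifs
    · rw [card_insert_of_notMem (by simp [hS]), card_insert_of_notMem (by simp [hT]), h r]
    · exact h r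

/-- Labels that no player carries contribute the factor `1`; each of the at most `k` others
contributes at most `n + 1`. -/
theorem numProfiles_le {k : ℕ} (i : ℕ) (hk : (univ.image fun j : Fin n => rep j).card ≤ k)
    (hrep : ∀ j < n, rep j < n) : numProfiles n rep i n ≤ (n + 1) ^ k := by
  have hsub : (univ.image fun j : Fin n => rep j) ⊆ range n := by
    intro r hr
    obtain ⟨j, _, rfl⟩ := mem_image.1 hr
    exact mem_range.2 (hrep j j.2)
  rw [numProfiles, ← prod_subset hsub]
  · refine (prod_le_pow_card _ _ (n + 1) fun r _ => ?_).trans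
      (Nat.pow_le_pow_right (Nat.succ_pos n) hk)
    simpa using card_le_univ (labelClass n rep i r)
  · intro r _ hr
    simp only [mem_image, mem_univ, true_and, not_exists] at hr
    simp [labelClass, hr]

end Profile

/-! ### Twins -/

namespace WeightedGraph

theorem link_comm {V : Type*} (G : WeightedGraph V) (a b : V) : G.link a b = G.link b a := by
  unfold link
  by_cases h : G.graph.Adj a b
  · have h' := h.symm
    rw [dif_pos h, dif_pos h']
    congr 2
    exact Subtype.ext Sym2.eq_swap
  · rw [dif_neg h, dif_neg fun h' => h h'.symm]

theorem link_self {V : Type*} (G : WeightedGraph V) (a : V) : G.link a a = none :=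
  dif_neg (SimpleGraph.irrefl _)

theorem link_induce {V : Type*} (G : WeightedGraph V) (S : Set V) (a b : S) :
    (G.induce S).link a b = G.link a b := by
  unfold link
  by_cases h : G.graph.Adj a b
  · rw [dif_pos h, dif_pos (show (G.induce S).graph.Adj a b from h)]
    rfl
  · rw [dif_neg h, dif_neg (show ¬ (G.induce S).graph.Adj a b from h)]

variable {n : ℕ} (G : WeightedGraph (Fin n))

open Classical in
/-- The function `link`, extended to all natural numbers. -/
noncomputable def natLink (i j : ℕ) : Option ℚ≥0 :=
  if h : i < n ∧ j < n then G.link ⟨i, h.1⟩ ⟨j, h.2⟩ else none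

@[simp] theorem natLink_val (i j : Fin n) : G.natLink i j = G.link i j := by simp [natLink]

theorem natLink_comm (i j : ℕ) : G.natLink i j = G.natLink j i := by
  unfold natLink
  by_cases h : i < n ∧ j < n
  · rw [dif_pos h, dif_pos h.symm, link_comm]
  · rw [dif_neg h, dif_neg fun h' => h h'.symm]

/-- Every other vertex is linked in the same way to `i` and to `j`. -/
def Twin (i j : ℕ) : Prop := ∀ c < n, c ≠ i → c ≠ j → G.natLink i c = G.natLink j c

variable {G}

theorem Twin.refl (i : ℕ) : G.Twin i i := fun _ _ _ _ => rfl

theorem Twin.symm {i j : ℕ} (h : G.Twin i j) : G.Twin j i :=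
  fun c hc hj hi => (h c hc hi hj).symm

/-- For distinct `i`, `j`, `l` the only vertex not covered by both hypotheses is `j` itself. There
the link `i`–`j` equals `i`–`l`, because `j` and `l` are twins, and this equals `j`–`l`, because `i`
and `j` are twins. -/
theorem Twin.trans {i j l : ℕ} (hi : i < n) (hl : l < n) (hij : G.Twin i j) (hjl : G.Twin j l) :
    G.Twin i l := by
  rcases eq_or_ne i j with rfl | h1
  · exact hjl
  rcases eq_or_ne j l with rfl | h2
  · exact hij
  rcases eq_or_ne i l with rfl | h3
  · exact .refl i
  intro d hd hdi hdl
  rcases eq_or_ne d j with rfl | hdj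
  · rw [natLink_comm G i, hjl i hi h1 h3, natLink_comm G l, hij l hl h3.symm h2.symm,
      natLink_comm G d]
  · exact (hij d hd hdi hdj).trans (hjl d hd hdj hdl)

/-- The endpoints are replaced one at a time, through the pair `x'`, `y`. This fails only if `x' =
y`; then either the two pairs are swapped copies of each other, or `x` and `y'` are twins by
transitivity and one replacement suffices. -/
theorem Twin.link_eq {x x' y y' : Fin n} (hx : G.Twin x x') (hy : G.Twin y y') (hxy : x ≠ y)
    (hxy' : x' ≠ y') : G.link x y = G.link x' y' := by
  have key : ∀ {x x' y y' : Fin n}, G.Twin x x' → G.Twin y y' → x ≠ y → x' ≠ y' → x' ≠ y →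
      G.link x y = G.link x' y' := by
    intro x x' y y' hx hy hxy hxy' h
    have h1 := hx y y.2 (Fin.val_ne_of_ne hxy.symm) (Fin.val_ne_of_ne h.symm)
    have h2 := hy x' x'.2 (Fin.val_ne_of_ne h) (Fin.val_ne_of_ne hxy')
    simp only [natLink_val] at h1 h2
    rw [h1, link_comm, h2, link_comm]
  by_cases h : x' = y
  · subst h
    by_cases h' : y' = x
    · subst h'
      exact link_comm _ _ _
    · have := (hx.trans x.2 y'.2 hy) x' x'.2 (Fin.val_ne_of_ne hxy.symm) (Fin.val_ne_of_ne hxy')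
      simp only [natLink_val] at this
      rw [this, link_comm]
  · exact key hx hy hxy hxy' h

variable (G)

open Classical in
/-- The first twin of `i`. -/
noncomputable def firstTwin (i : ℕ) : ℕ :=
  ((Finset.range n).filter fun j => ∀ l < n, l ≤ j → ¬ G.Twin i l).card

variable {G}

/-- The indices `j` such that no `l ≤ j` is a twin of `i` form the initial segment below the least
twin, so their number is that least twin. Defining it as a count is what lets
`PolyTimePred.card_range` compute it. -/
theorem firstTwin_spec {i : ℕ} (hi : i < n) :
    G.firstTwin i < n ∧ G.Twin i (G.firstTwin i) ∧ ∀ l < G.firstTwin i, ¬ G.Twin i l := by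
  classical
  have hex : ∃ j, G.Twin i j := ⟨i, .refl i⟩
  have hle : Nat.find hex ≤ i := Nat.find_min' hex (.refl i)
  have : G.firstTwin i = Nat.find hex := by
    rw [firstTwin, show ((Finset.range n).filter fun j => ∀ l < n, l ≤ j → ¬ G.Twin i l) =
      Finset.range (Nat.find hex) from ?_, Finset.card_range]
    ext j
    simp only [Finset.mem_filter, Finset.mem_range]
    constructor
    · rintro ⟨_, h⟩
      by_contra hj
      exact h _ (by omega) (by omega) (Nat.find_spec hex)
    · intro h
      exact ⟨by omega, fun l _ hl => Nat.find_min hex (by omega)⟩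
  rw [this]
  exact ⟨by omega, Nat.find_spec hex, fun l hl => Nat.find_min hex hl⟩

theorem firstTwin_eq_iff {i j : ℕ} (hi : i < n) (hj : j < n) :
    G.firstTwin i = G.firstTwin j ↔ G.Twin i j := by
  obtain ⟨hi1, hi2, hi3⟩ := firstTwin_spec (G := G) hi
  obtain ⟨hj1, hj2, hj3⟩ := firstTwin_spec (G := G) hj
  constructor
  · intro h
    rw [← h] at hj2
    exact hi2.trans hi hj hj2.symm
  · intro h
    refine le_antisymm (not_lt.1 fun hlt => ?_) (not_lt.1 fun hlt => ?_)
    · exact hi3 _ hlt (h.trans hi hj1 hj2)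
    · exact hj3 _ hlt (h.symm.trans hj hi1 hi2)

/-- Coalitions with the same number of players in each twin class induce isomorphic graphs. -/
theorem isomorphic_of_card_eq {S T : Finset (Fin n)}
    (h : ∀ r, (S.filter fun j : Fin n => G.firstTwin j = r).card =
      (T.filter fun j : Fin n => G.firstTwin j = r).card) :
    (G.induce (S : Set (Fin n))).Isomorphic (G.induce (T : Set (Fin n))) := by
  classical
  have hcard : ∀ (U : Finset (Fin n)) (r : ℕ),
      Fintype.card {x : (U : Set (Fin n)) // G.firstTwin x = r} =
        (U.filter fun j : Fin n => G.firstTwin j = r).card := by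
    intro U r
    rw [Fintype.card_subtype, ← Finset.card_map (Function.Embedding.subtype _)]
    congr 1
    ext j
    simp
    tauto
  -- The bijections within the classes are arbitrary; `Twin.link_eq` makes whatever they glue to an
  -- isomorphism.
  let e : ∀ r, {x : (S : Set (Fin n)) // G.firstTwin x = r} ≃
      {x : (T : Set (Fin n)) // G.firstTwin x = r} := fun r =>
    Fintype.equivOfCardEq (by rw [hcard, hcard, h])
  let f := Equiv.ofFiberEquiv e
  have hf : ∀ x, G.firstTwin (f x : Fin n) = G.firstTwin (x : Fin n) := Equiv.ofFiberEquiv_map e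
  refine ⟨f, fun a b => ?_⟩
  rw [link_induce, link_induce]
  by_cases hab : a = b
  · subst hab
    rw [link_self, link_self]
  · refine Twin.link_eq ((firstTwin_eq_iff (f a : Fin n).2 (a : Fin n).2).1 (hf a))
      ((firstTwin_eq_iff (f b : Fin n).2 (b : Fin n).2).1 (hf b)) (fun h => hab ?_)
      fun h => hab (Subtype.ext h)
    exact f.injective (Subtype.ext h)

/-- Members of one part are twins: vertices outside the part are handled by the module property,
those inside by the constant link `w`. So each part meets a single twin class. The value `w = none`
is the coclique case and `some _` the clique case. -/
theorem card_image_firstTwin_le {k : ℕ} (γ : Finpartition (Finset.univ : Finset (Fin n)))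
    (hγ : γ.parts.card ≤ k)
    (h : ∀ M ∈ γ.parts, G.IsModule M ∧ ∃ w, ∀ a ∈ M, ∀ b ∈ M, a ≠ b → G.link a b = w) :
    (Finset.univ.image fun j : Fin n => G.firstTwin j).card ≤ k := by
  classical
  have key : ∀ M ∈ γ.parts, ∀ a ∈ M, ∀ b ∈ M,
      G.firstTwin (a : Fin n) = G.firstTwin (b : Fin n) := by
    intro M hM a ha b hb
    obtain ⟨hmod, w, hw⟩ := h M hM
    rw [firstTwin_eq_iff a.2 b.2]
    intro c hc hca hcb
    lift c to Fin n using hc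
    rw [natLink_val, natLink_val]
    by_cases hcM : c ∈ M
    · rw [hw a ha c hcM fun h => hca (by rw [h]), hw b hb c hcM fun h => hcb (by rw [h])]
    · exact hmod a ha b hb c hcM
  refine le_trans ?_ hγ
  refine Finset.card_le_card_of_surjOn
    -- The default `0` is harmless: the part that contains a given player is nonempty.
    (fun M => if hM : M.Nonempty then G.firstTwin (hM.choose : Fin n) else 0) ?_
  intro r hr
  obtain ⟨j, _, rfl⟩ := Finset.mem_image.1 (Finset.mem_coe.1 hr)
  have hjM := γ.mem_part (Finset.mem_univ j)
  have hne : (γ.part j).Nonempty := ⟨j, hjM⟩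
  have hM := γ.part_mem.2 (Finset.mem_univ j)
  refine ⟨γ.part j, hM, ?_⟩
  simp only [dif_pos hne]
  exact key _ hM _ hne.choose_spec _ hjM

theorem card_image_firstTwin_le_of_decomposition {k : ℕ}
    (h : G.HasCocliqueDecomposition k ∨ (G.IsUnweighted ∧ G.HasCliqueDecomposition k)) :
    (Finset.univ.image fun j : Fin n => G.firstTwin j).card ≤ k := by
  rcases h with ⟨γ, hγ, h⟩ | ⟨_, γ, hγ, h⟩
  · exact card_image_firstTwin_le γ hγ fun M hM =>
      ⟨(h M hM).1, none, fun a ha b hb _ => dif_neg ((h M hM).2 a ha b hb)⟩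
  · exact card_image_firstTwin_le γ hγ fun M hM =>
      ⟨(h M hM).1, let ⟨w, hw⟩ := (h M hM).2; ⟨some w, hw⟩⟩

end WeightedGraph

/-! ### The algorithm: twin labels, profiles and fractions in the machine model. -/

namespace BitCost

/-! ### Fractions -/

/-- The machine has only natural numbers, so a signed numerator is kept as a difference `P - Q`. Of
the two truncated differences one is zero, so their sum is the absolute value. -/
theorem encodeRat_eq {q : ℚ} {P Q y : ℕ} (hy : y ≠ 0) (hq : q = ((P : ℚ) - Q) / y) :
    encodeRat q = [if P < Q then 1 else 0, ((P - Q) + (Q - P)) / Nat.gcd ((P - Q) + (Q - P)) y,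
      y / Nat.gcd ((P - Q) + (Q - P)) y] := by
  have habs : ((P : ℤ) - Q).natAbs = (P - Q) + (Q - P) := by omega
  have hq' : q = mkRat ((P : ℤ) - Q) y := by
    rw [Rat.mkRat_eq_div, hq]; push_cast; rfl
  have hneg : q < 0 ↔ P < Q := by
    have hy' : (0 : ℚ) < y := by exact_mod_cast Nat.pos_of_ne_zero hy
    rw [hq, div_lt_iff₀ hy', zero_mul, sub_neg, Nat.cast_lt]
  have hnum : q.num.natAbs = ((P - Q) + (Q - P)) / Nat.gcd ((P - Q) + (Q - P)) y := by
    rw [hq', Rat.num_mkRat, if_neg hy, Int.natAbs_ediv, if_pos (Or.inr (Or.inr ?_)), add_zero,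
      habs, Int.natAbs_natCast, Nat.gcd_comm]
    exact Int.natCast_dvd.2 (Nat.gcd_dvd_right _ _)
  have hden : q.den = y / Nat.gcd ((P - Q) + (Q - P)) y := by
    rw [hq', Rat.den_mkRat, if_neg hy, habs, Nat.gcd_comm]
  simp only [encodeRat, hneg, hnum, hden]

/-- Numerator of the positive part. -/
def posNum (q : ℚ) : ℕ := q.num.toNat

/-- Numerator of the negative part. -/
def negNum (q : ℚ) : ℕ := (-q.num).toNat

theorem posNum_sub_negNum (q : ℚ) : ((posNum q : ℚ) - negNum q) / q.den = q := by
  have h : ((posNum q : ℤ) - negNum q) = q.num := by unfold posNum negNum; omega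
  have h' : ((posNum q : ℚ) - negNum q) = q.num := by exact_mod_cast h
  rw [h', Rat.num_div_den]

/-- A common denominator. -/
def commonDen (T : ℕ) (q₁ q₀ : ℕ → ℚ) : ℕ := ∏ c ∈ Finset.range T, (q₁ c).den * (q₀ c).den

/-- The positive part of the numerator of `∑ c, W c * (q₁ c - q₀ c)`. -/
def posPart (T : ℕ) (W : ℕ → ℕ) (q₁ q₀ : ℕ → ℚ) : ℕ :=
  ∑ c ∈ Finset.range T, W c * (posNum (q₁ c) * (commonDen T q₁ q₀ / (q₁ c).den) +
    negNum (q₀ c) * (commonDen T q₁ q₀ / (q₀ c).den))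

theorem commonDen_ne_zero (T : ℕ) (q₁ q₀ : ℕ → ℚ) : commonDen T q₁ q₀ ≠ 0 :=
  Finset.prod_ne_zero_iff.2 fun c _ => mul_ne_zero (q₁ c).den_ne_zero (q₀ c).den_ne_zero

theorem commonDen_comm (T : ℕ) (q₁ q₀ : ℕ → ℚ) : commonDen T q₁ q₀ = commonDen T q₀ q₁ :=
  Finset.prod_congr rfl fun _ _ => mul_comm _ _

/-- In `q₁ - q₀` the positive contributions are the positive part of `q₁` and the negative part of
`q₀`, so exchanging the two families turns `posPart` into the part to be subtracted. The integer
divisions are exact because every denominator divides the common one. -/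
theorem sum_eq_div_commonDen (T : ℕ) (W : ℕ → ℕ) (q₁ q₀ : ℕ → ℚ) :
    ∑ c ∈ Finset.range T, (W c : ℚ) * (q₁ c - q₀ c) =
      ((posPart T W q₁ q₀ : ℚ) - posPart T W q₀ q₁) / commonDen T q₁ q₀ := by
  have hD : (commonDen T q₁ q₀ : ℚ) ≠ 0 := by exact_mod_cast commonDen_ne_zero T q₁ q₀
  have hdvd : ∀ c ∈ Finset.range T, (q₁ c).den * (q₀ c).den ∣ commonDen T q₁ q₀ := fun c hc =>
    Finset.dvd_prod_of_mem _ hc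
  rw [eq_div_iff hD, posPart, posPart, commonDen_comm T q₀ q₁, Nat.cast_sum, Nat.cast_sum,
    ← Finset.sum_sub_distrib, Finset.sum_mul]
  refine Finset.sum_congr rfl fun c hc => ?_
  have h1 : ((commonDen T q₁ q₀ / (q₁ c).den : ℕ) : ℚ) = commonDen T q₁ q₀ / (q₁ c).den :=
    Nat.cast_div (dvd_of_mul_right_dvd (hdvd c hc)) (by exact_mod_cast (q₁ c).den_ne_zero)
  have h0 : ((commonDen T q₁ q₀ / (q₀ c).den : ℕ) : ℚ) = commonDen T q₁ q₀ / (q₀ c).den :=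
    Nat.cast_div (dvd_of_mul_left_dvd (hdvd c hc)) (by exact_mod_cast (q₀ c).den_ne_zero)
  push_cast
  rw [h1, h0]
  nth_rewrite 1 [← posNum_sub_negNum (q₁ c), ← posNum_sub_negNum (q₀ c)]
  ring

/-! ### Words as tables -/

theorem getD_flatten_ofFn {n L : ℕ} (f : Fin n → List ℕ) (hf : ∀ i, (f i).length = L) (i : Fin n)
    {t : ℕ} (ht : t < L) (d : ℕ) :
    (List.ofFn f).flatten.getD (L * i + t) d = (f i).getD t d := by
  induction n with
  | zero => exact i.elim0
  | succ n ih =>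
    rw [List.ofFn_succ, List.flatten_cons]
    refine Fin.cases ?_ (fun i => ?_) i
    · rw [List.getD_append _ _ _ _ (by simpa [hf] using ht)]
      simp
    · rw [List.getD_append_right _ _ _ _ (by rw [hf, Fin.val_succ, mul_add]; omega), hf,
        ← ih (fun i => f i.succ) (fun i => hf _) i]
      congr 1
      rw [Fin.val_succ, mul_add]; omega

theorem length_encodeLink (o : Option ℚ≥0) : (encodeLink o).length = 3 := by
  cases o <;> rfl

theorem encodeLink_inj {o o' : Option ℚ≥0} :
    o = o' ↔ (encodeLink o).getD 0 0 = (encodeLink o').getD 0 0 ∧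
    (encodeLink o).getD 1 0 = (encodeLink o').getD 1 0 ∧
    (encodeLink o).getD 2 0 = (encodeLink o').getD 2 0 := by
  refine ⟨fun h => by simp [h], ?_⟩
  cases o <;> cases o' <;> simp [encodeLink]
  exact fun h h' => NNRat.ext_num_den h h'

theorem getD_encodeGraph {n : ℕ} (G : WeightedGraph (Fin n)) (i j : Fin n) {t : ℕ} (ht : t < 3) :
    (encodeGraph G).getD (1 + (3 * n * i + (3 * j + t))) 0 =
      (encodeLink (G.link i j)).getD t 0 := by
  rw [encodeGraph, add_comm 1, List.getD_cons_succ]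
  have hlen : ∀ i : Fin n,
      ((List.ofFn fun j => encodeLink (G.link i j)).flatten).length = 3 * n := by
    intro i
    rw [List.length_flatten, List.map_ofFn, List.sum_ofFn]
    simp [length_encodeLink, mul_comm]
  have : 3 * (j : ℕ) + t < 3 * n := by have := j.2; omega
  rw [getD_flatten_ofFn _ hlen i this, getD_flatten_ofFn _ (fun _ => length_encodeLink _) j ht]

theorem flatten_ofFn_eq_flatMap {n : ℕ} (f : ℕ → List ℕ) :
    (List.ofFn fun i : Fin n => f i).flatten = (List.range n).flatMap f := by
  rw [List.flatMap_def]
  congr 1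
  refine List.ext_getElem (by simp) fun i h _ => by simp

theorem encodeCoalition_filter {n : ℕ} (P : ℕ → Prop) [DecidablePred P] :
    encodeCoalition (Finset.univ.filter fun j : Fin n => P j) =
      (List.range n).flatMap fun j => [if P j then 1 else 0] := by
  rw [← List.map_eq_flatMap, encodeCoalition]
  exact List.ext_getElem (by simp) fun i h _ => by simp


/-! ### Computing profiles -/

theorem card_filter_fin {n : ℕ} (P : ℕ → Prop) [DecidablePred P] :
    ((Finset.univ : Finset (Fin n)).filter fun j : Fin n => P j).card =
      ((Finset.range n).filter P).card := by
  rw [Finset.card_filter, Finset.card_filter, Finset.sum_range]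

/-- The adjacency matrix is written out in full, so the value of `n`, and not only its bit length,
is bounded by the input size. This permits loops over all players. -/
theorem le_size_encodeGraph {n : ℕ} (G : WeightedGraph (Fin n)) : n ≤ size (encodeGraph G) := by
  refine le_trans ?_ (length_le_size _)
  rw [encodeGraph, List.length_cons, List.length_flatten, List.map_ofFn, List.sum_ofFn]
  simp only [Function.comp_def, List.length_flatten, List.map_ofFn, List.sum_ofFn,
    length_encodeLink, Finset.sum_const, Finset.card_univ, Fintype.card_fin, smul_eq_mul]
  rcases Nat.eq_zero_or_pos n with rfl | hn
  · simp
  · nlinarith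

theorem getD_encodeLink_natLink {n : ℕ} (G : WeightedGraph (Fin n)) (i j : ℕ) {t : ℕ} (ht : t < 3) :
    (encodeLink (G.natLink i j)).getD t 0 =
      if i < n ∧ j < n then (encodeGraph G).getD (1 + (3 * n * i + (3 * j + t))) 0 else 0 := by
  split_ifs with h
  · lift i to Fin n using h.1
    lift j to Fin n using h.2
    rw [getD_encodeGraph G i j ht, WeightedGraph.natLink_val]
  · rw [WeightedGraph.natLink, dif_neg h]
    interval_cases t <;> rfl

theorem PolyTimeNat.ite {ι : Type*} {code : ι → List ℕ} {P : ι → Prop} [DecidablePred P]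
    {f g : ι → ℕ} (hP : PolyTimePred code P) (hf : PolyTimeNat code f) (hg : PolyTimeNat code g) :
    PolyTimeNat code fun a => if P a then f a else g a := by
  convert (hP.indicator.mul hf).add (((PolyTimeNat.const 1).sub hP.indicator).mul hg) using 3 with a
  split_ifs <;> simp

theorem PolyTimePred.card_fin {ι : Type*} {code : ι → List ℕ} {N : ι → ℕ} (P : ι → ℕ → Prop)
    [∀ a, DecidablePred fun j : Fin (N a) => P a j] (hN : PolyTimeNat code N)
    (hNB : PolyBounded code N) (hP : PolyTimePred (push code) fun p => P p.1 p.2) :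
    PolyTimeNat code fun a =>
      ((Finset.univ : Finset (Fin (N a))).filter fun j : Fin (N a) => P a j).card := by
  classical
  refine (PolyTimePred.card_range hN hNB hP).of_eq fun a => ?_
  rw [← card_filter_fin]
  congr

theorem polyTimeComputable_encodeCoalition {κ : Type*} {c : κ → List ℕ} {n : κ → ℕ}
    (P : κ → ℕ → Prop) [∀ x, DecidablePred fun j : Fin (n x) => P x j] (hn : PolyTimeNat c n)
    (hnB : PolyBounded c n) (hP : PolyTimePred (push c) fun p => P p.1 p.2) :
    PolyTimeComputable c fun x =>
      encodeCoalition ((Finset.univ : Finset (Fin (n x))).filter fun j : Fin (n x) => P x j) := by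
  classical
  convert hn.flatMap (f := fun x j => [if P x j then 1 else 0]) hnB hP.indicator using 2 with x
  rw [← encodeCoalition_filter]
  congr

section Profiles

variable {κ : Type*} {c : κ → List ℕ} {n : κ → ℕ} {G : ∀ x, WeightedGraph (Fin (n x))}
  {i j i' j' r d : κ → ℕ}

theorem polyTimeNat_numVertices (hG : PolyTimeComputable c fun x => encodeGraph (G x)) :
    PolyTimeNat c n := by
  simpa [encodeGraph] using hG.getD (.const 0)

theorem polyBounded_numVertices (hG : PolyTimeComputable c fun x => encodeGraph (G x)) :
    PolyBounded c n :=
  hG.polyBounded.mono fun x => le_size_encodeGraph (G x)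

theorem polyTimePred_natLink_eq (hG : PolyTimeComputable c fun x => encodeGraph (G x))
    (hi : PolyTimeNat c i) (hj : PolyTimeNat c j) (hi' : PolyTimeNat c i')
    (hj' : PolyTimeNat c j') :
    PolyTimePred c fun x => (G x).natLink (i x) (j x) = (G x).natLink (i' x) (j' x) := by
  have hn := polyTimeNat_numVertices hG
  have key : ∀ t < 3, ∀ {i j : κ → ℕ}, PolyTimeNat c i → PolyTimeNat c j →
      PolyTimeNat c fun x => (encodeLink ((G x).natLink (i x) (j x))).getD t 0 := by
    intro t ht i j hi hj
    simp only [getD_encodeLink_natLink _ _ _ ht]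
    exact .ite ((PolyTimePred.lt hi hn).and (.lt hj hn)) (hG.getD ((PolyTimeNat.const 1).add
      ((((PolyTimeNat.const 3).mul hn).mul hi).add (((PolyTimeNat.const 3).mul hj).add
      (.const t))))) (.const 0)
  have heq : ∀ t < 3, PolyTimePred c fun x => (encodeLink ((G x).natLink (i x) (j x))).getD t 0 =
      (encodeLink ((G x).natLink (i' x) (j' x))).getD t 0 := fun t ht =>
    .eq (key t ht hi hj) (key t ht hi' hj')
  exact ((heq 0 (by norm_num)).and ((heq 1 (by norm_num)).and (heq 2 (by norm_num)))).of_iff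
    fun x => encodeLink_inj

theorem polyTimePred_twin (hG : PolyTimeComputable c fun x => encodeGraph (G x))
    (hi : PolyTimeNat c i) (hj : PolyTimeNat c j) :
    PolyTimePred c fun x => (G x).Twin (i x) (j x) :=
  PolyTimePred.forall_lt (polyTimeNat_numVertices hG) (polyBounded_numVertices hG)
    ((PolyTimePred.eq .var hi.lift).not.imp ((PolyTimePred.eq .var hj.lift).not.imp
      (polyTimePred_natLink_eq (G := fun p => G p.1) hG.lift hi.lift .var hj.lift .var)))

theorem polyTimeNat_firstTwin (hG : PolyTimeComputable c fun x => encodeGraph (G x))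
    (hi : PolyTimeNat c i) : PolyTimeNat c fun x => (G x).firstTwin (i x) := by
  classical
  exact PolyTimePred.card_range (polyTimeNat_numVertices hG) (polyBounded_numVertices hG)
    (PolyTimePred.forall_lt (polyTimeNat_numVertices hG).lift (polyBounded_numVertices hG).lift
      ((PolyTimePred.lt PolyTimeNat.var.lift .var).not.imp
      (polyTimePred_twin (G := fun p => G p.1.1) hG.lift.lift hi.lift.lift .var).not |>.of_iff
      fun _ => by rw [not_lt]))

/-- Valid also for `i ≥ n`, where `firstTwin_spec` says nothing; computability is claimed for all
values of an index. -/
theorem firstTwin_le {n : ℕ} (G : WeightedGraph (Fin n)) (i : ℕ) : G.firstTwin i ≤ n := by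
  classical
  exact (Finset.card_filter_le _ _).trans (Finset.card_range n).le

theorem polyTimeNat_card_labelClass (hG : PolyTimeComputable c fun x => encodeGraph (G x))
    (hi : PolyTimeNat c i) (hr : PolyTimeNat c r) :
    PolyTimeNat c fun x => (labelClass (n x) (G x).firstTwin (i x) (r x)).card := by
  exact PolyTimePred.card_fin (fun x j => j ≠ i x ∧ (G x).firstTwin j = r x)
    (polyTimeNat_numVertices hG) (polyBounded_numVertices hG)
    ((PolyTimePred.eq .var hi.lift).not.and (.eq
      (polyTimeNat_firstTwin (G := fun p => G p.1) hG.lift .var) hr.lift))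

theorem polyBounded_card_labelClass (hG : PolyTimeComputable c fun x => encodeGraph (G x)) :
    PolyBounded c fun x => (labelClass (n x) (G x).firstTwin (i x) (r x)).card :=
  (polyBounded_numVertices hG).mono fun x => by
    simpa using Finset.card_le_univ (labelClass (n x) (G x).firstTwin (i x) (r x))

theorem polyTimeNat_numProfiles (hG : PolyTimeComputable c fun x => encodeGraph (G x))
    (hi : PolyTimeNat c i) (hr : PolyTimeNat c r) (hrn : ∀ x, r x ≤ n x) :
    PolyTimeNat c fun x => numProfiles (n x) (G x).firstTwin (i x) (r x) :=
  hr.prod ((polyBounded_numVertices hG).mono hrn)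
    ((polyTimeNat_card_labelClass (G := fun p => G p.1) hG.lift hi.lift .var).add (.const 1))

theorem polyTimeNat_profileDigit (hG : PolyTimeComputable c fun x => encodeGraph (G x))
    (hi : PolyTimeNat c i) (hd : PolyTimeNat c d) (hr : PolyTimeNat c r) (hrn : ∀ x, r x ≤ n x) :
    PolyTimeNat c fun x => profileDigit (n x) (G x).firstTwin (i x) (d x) (r x) :=
  (hd.div (polyTimeNat_numProfiles hG hi hr hrn)).mod
    ((polyTimeNat_card_labelClass hG hi hr).add (.const 1))

theorem polyTimeNat_profileMultiplicity (hG : PolyTimeComputable c fun x => encodeGraph (G x))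
    (hi : PolyTimeNat c i) (hd : PolyTimeNat c d) :
    PolyTimeNat c fun x => profileMultiplicity (n x) (G x).firstTwin (i x) (d x) := by
  have hn := polyTimeNat_numVertices hG
  -- This is the minimum of `p.2` and `n p.1`. It keeps the digit index within `n` for arbitrary
  -- `p`, and changes nothing inside the product, where `r < n`.
  have hr : PolyTimeNat (push c) fun p => p.2 - (p.2 - n p.1) :=
    PolyTimeNat.var.sub (PolyTimeNat.var.sub hn.lift)
  have hrn : ∀ p : κ × ℕ, p.2 - (p.2 - n p.1) ≤ n p.1 := fun p => by omega
  have h := PolyTimeNat.choose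
    (polyTimeNat_card_labelClass (G := fun p : κ × ℕ => G p.1) hG.lift hi.lift hr)
    (polyBounded_card_labelClass (G := fun p : κ × ℕ => G p.1) hG.lift)
    (polyTimeNat_profileDigit (G := fun p : κ × ℕ => G p.1) hG.lift hi.lift hd.lift hr hrn)
    fun p => profileDigit_le _ _ _ _
  refine (hn.prod (f := fun x r => (labelClass (n x) (G x).firstTwin (i x)
    (r - (r - n x))).card.choose (profileDigit (n x) (G x).firstTwin (i x) (d x)
    (r - (r - n x)))) (polyBounded_numVertices hG) h).of_eq fun x => ?_
  unfold profileMultiplicity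
  refine Finset.prod_congr rfl fun r hr => ?_
  have := Finset.mem_range.1 hr
  rw [show r - (r - n x) = r by omega]

theorem polyTimeNat_labelRank (hG : PolyTimeComputable c fun x => encodeGraph (G x))
    (hi : PolyTimeNat c i) (hj : PolyTimeNat c j) :
    PolyTimeNat c fun x => labelRank (n x) (G x).firstTwin (i x) (j x) := by
  simp only [labelRank, labelClass, Finset.filter_filter]
  exact PolyTimePred.card_fin
    (fun x l => (l ≠ i x ∧ (G x).firstTwin l = (G x).firstTwin (j x)) ∧ l < j x)
    (polyTimeNat_numVertices hG) (polyBounded_numVertices hG)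
    (((PolyTimePred.eq .var hi.lift).not.and (.eq
      (polyTimeNat_firstTwin (G := fun p => G p.1) hG.lift .var)
      (polyTimeNat_firstTwin hG hj).lift)).and (.lt .var hj.lift))

/-- Membership in `profileCoalition`. -/
abbrev InProfileCoalition (n : ℕ) (rep : ℕ → ℕ) (i d j : ℕ) : Prop :=
  j ≠ i ∧ labelRank n rep i j < profileDigit n rep i d (rep j)

theorem polyTimePred_inProfileCoalition (hG : PolyTimeComputable c fun x => encodeGraph (G x))
    (hi : PolyTimeNat c i) (hd : PolyTimeNat c d) (hj : PolyTimeNat c j) :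
    PolyTimePred c fun x => InProfileCoalition (n x) (G x).firstTwin (i x) (d x) (j x) :=
  (PolyTimePred.eq hj hi).not.and (.lt (polyTimeNat_labelRank hG hi hj)
    (polyTimeNat_profileDigit hG hi hd (polyTimeNat_firstTwin hG hj) fun _ => firstTwin_le _ _))

theorem polyTimeNat_card_profileCoalition (hG : PolyTimeComputable c fun x => encodeGraph (G x))
    (hi : PolyTimeNat c i) (hd : PolyTimeNat c d) :
    PolyTimeNat c fun x => (profileCoalition (n x) (G x).firstTwin (i x) (d x)).card := by
  exact PolyTimePred.card_fin (fun x => InProfileCoalition (n x) (G x).firstTwin (i x) (d x))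
    (polyTimeNat_numVertices hG) (polyBounded_numVertices hG)
    (polyTimePred_inProfileCoalition (G := fun p => G p.1) hG.lift hi.lift hd.lift .var)

theorem polyTimeNat_profileWeight (hG : PolyTimeComputable c fun x => encodeGraph (G x))
    (hi : PolyTimeNat c i) (hd : PolyTimeNat c d) :
    PolyTimeNat c fun x => profileWeight (n x) (G x).firstTwin (i x) (d x) := by
  have hn := polyTimeNat_numVertices hG
  have hnB := polyBounded_numVertices hG
  have hcard := polyTimeNat_card_profileCoalition hG hi hd
  exact ((polyTimeNat_profileMultiplicity hG hi hd).mul (hcard.factorial (hnB.mono fun x =>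
    (Finset.card_le_univ _).trans (Fintype.card_fin _).le))).mul
    (((hn.sub hcard).sub (.const 1)).factorial
      (hnB.mono fun x => (Nat.sub_le _ _).trans (Nat.sub_le _ _)))

theorem polyTimeComputable_profileCoalition (hG : PolyTimeComputable c fun x => encodeGraph (G x))
    (hi : PolyTimeNat c i) (hd : PolyTimeNat c d) :
    PolyTimeComputable c fun x =>
      encodeCoalition (profileCoalition (n x) (G x).firstTwin (i x) (d x)) :=
  polyTimeComputable_encodeCoalition
    (fun x j => InProfileCoalition (n x) (G x).firstTwin (i x) (d x) j)
    (polyTimeNat_numVertices hG) (polyBounded_numVertices hG)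
    (polyTimePred_inProfileCoalition (G := fun p => G p.1) hG.lift hi.lift hd.lift .var)

theorem polyTimeComputable_joinedCoalition (hG : PolyTimeComputable c fun x => encodeGraph (G x))
    (hi : PolyTimeNat c i) (hd : PolyTimeNat c d) :
    PolyTimeComputable c fun x =>
      encodeCoalition (joinedCoalition (n x) (G x).firstTwin (i x) (d x)) :=
  polyTimeComputable_encodeCoalition
    (fun x j => j = i x ∨ InProfileCoalition (n x) (G x).firstTwin (i x) (d x) j)
    (polyTimeNat_numVertices hG) (polyBounded_numVertices hG)
    ((PolyTimePred.eq .var hi.lift).or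
      (polyTimePred_inProfileCoalition (G := fun p => G p.1) hG.lift hi.lift hd.lift .var))

end Profiles


/-! ### Computing sums of fractions -/

section Fractions

variable {κ : Type*} {c : κ → List ℕ}

theorem polyTimeNat_posNum {q : κ → ℚ} (hq : PolyTimeComputable c fun x => encodeRat (q x)) :
    PolyTimeNat c fun x => posNum (q x) := by
  refine (((PolyTimeNat.const 1).sub (hq.getD (.const 0))).mul (hq.getD (.const 1))).of_eq
    fun x => ?_
  have h : q x < 0 ↔ (q x).num < 0 := Rat.num_neg.symm
  by_cases h0 : (q x).num < 0
  · simp [encodeRat, h, h0, posNum, h0.le]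
  · simp [encodeRat, h, h0, posNum]; omega

theorem polyTimeNat_negNum {q : κ → ℚ} (hq : PolyTimeComputable c fun x => encodeRat (q x)) :
    PolyTimeNat c fun x => negNum (q x) := by
  refine ((hq.getD (.const 0)).mul (hq.getD (.const 1))).of_eq fun x => ?_
  have h : q x < 0 ↔ (q x).num < 0 := Rat.num_neg.symm
  by_cases h0 : (q x).num < 0
  · simp [encodeRat, h, h0, negNum]; omega
  · rw [negNum, Int.toNat_of_nonpos (by omega)]
    simp [encodeRat, h, h0]

theorem polyTimeNat_den {q : κ → ℚ} (hq : PolyTimeComputable c fun x => encodeRat (q x)) :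
    PolyTimeNat c fun x => (q x).den :=
  (hq.getD (.const 2)).of_eq fun x => by simp [encodeRat]

variable {T y : κ → ℕ} {W : κ → ℕ → ℕ} {q₁ q₀ : κ → ℕ → ℚ}

theorem polyTimeNat_commonDen (hT : PolyTimeNat c T) (hTB : PolyBounded c T)
    (hq₁ : PolyTimeComputable (push c) fun p => encodeRat (q₁ p.1 p.2))
    (hq₀ : PolyTimeComputable (push c) fun p => encodeRat (q₀ p.1 p.2)) :
    PolyTimeNat c fun x => commonDen (T x) (q₁ x) (q₀ x) :=
  hT.prod (f := fun x d => (q₁ x d).den * (q₀ x d).den) hTB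
    ((polyTimeNat_den hq₁).mul (polyTimeNat_den hq₀))

theorem polyTimeNat_posPart (hT : PolyTimeNat c T) (hTB : PolyBounded c T)
    (hW : PolyTimeNat (push c) fun p => W p.1 p.2)
    (hq₁ : PolyTimeComputable (push c) fun p => encodeRat (q₁ p.1 p.2))
    (hq₀ : PolyTimeComputable (push c) fun p => encodeRat (q₀ p.1 p.2)) :
    PolyTimeNat c fun x => posPart (T x) (W x) (q₁ x) (q₀ x) := by
  have hD := (polyTimeNat_commonDen hT hTB hq₁ hq₀).lift
  exact hT.sum (f := fun x d => W x d * (posNum (q₁ x d) * (commonDen (T x) (q₁ x) (q₀ x) /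
    (q₁ x d).den) + negNum (q₀ x d) * (commonDen (T x) (q₁ x) (q₀ x) / (q₀ x d).den))) hTB
    (hW.mul (((polyTimeNat_posNum hq₁).mul (hD.div (polyTimeNat_den hq₁))).add
      ((polyTimeNat_negNum hq₀).mul (hD.div (polyTimeNat_den hq₀)))))

/-- Sums of polynomially many fractions can be computed, in lowest terms. -/
theorem polyTimeComputable_encodeRat_sum (hT : PolyTimeNat c T) (hTB : PolyBounded c T)
    (hW : PolyTimeNat (push c) fun p => W p.1 p.2)
    (hq₁ : PolyTimeComputable (push c) fun p => encodeRat (q₁ p.1 p.2))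
    (hq₀ : PolyTimeComputable (push c) fun p => encodeRat (q₀ p.1 p.2))
    (hy : PolyTimeNat c y) (hy0 : ∀ x, y x ≠ 0) :
    PolyTimeComputable c fun x =>
      encodeRat ((∑ d ∈ Finset.range (T x), (W x d : ℚ) * (q₁ x d - q₀ x d)) / y x) := by
  have hP := polyTimeNat_posPart hT hTB hW hq₁ hq₀
  have hQ := polyTimeNat_posPart hT hTB hW hq₀ hq₁
  have hz := (polyTimeNat_commonDen hT hTB hq₁ hq₀).mul hy
  have ha := (hP.sub hQ).add (hQ.sub hP)
  have hg := ha.gcd hz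
  have h := PolyTimeComputable.append (PolyTimePred.lt hP hQ).indicator
    (PolyTimeComputable.append (ha.div hg) (hz.div hg))
  convert h using 2 with x
  exact encodeRat_eq (mul_ne_zero (commonDen_ne_zero _ _ _) (hy0 x)) (by
    rw [sum_eq_div_commonDen, div_div]; push_cast; rfl)

end Fractions

theorem polyTimeComputable_encodePair {κ : Type*} {c f g : κ → List ℕ}
    (hf : PolyTimeComputable c f) (hg : PolyTimeComputable c g) :
    PolyTimeComputable c fun x => encodePair (f x) (g x) :=
  PolyTimeComputable.append (polyTimeNat_length.comp hf) (hf.append hg)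

end BitCost

/-! ### Assembly of the algorithm. -/

open BitCost in
theorem mainTheorem5 (k : ℕ) {I : Type*} (code : I → List ℕ) (n : I → ℕ)
    (v : ∀ a : I, CoopGame (Fin (n a))) (G : ∀ a : I, WeightedGraph (Fin (n a)))
    (hbased : ∀ a, (v a).IsSubgraphBasedOn (G a))
    (hgraph : BitCost.PolyTimeComputable code fun a => BitCost.encodeGraph (G a))
    (hdecomp : ∀ a, (G a).HasCocliqueDecomposition k ∨
      ((G a).IsUnweighted ∧ (G a).HasCliqueDecomposition k))
    (hvalue : BitCost.PolyTimeComputable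
      (fun q : (a : I) × Finset (Fin (n a)) =>
        BitCost.encodePair (code q.1) (BitCost.encodeCoalition q.2))
      (fun q => BitCost.encodeRat (v q.1 q.2))) :
    BitCost.PolyTimeComputable code fun a => BitCost.encodeShapley (v a) := by
  have hn := polyTimeNat_numVertices hgraph
  have hnB := polyBounded_numVertices hgraph
  have hrep : ∀ a, ∀ j < n a, (G a).firstTwin j < n a := fun a j hj =>
    (WeightedGraph.firstTwin_spec hj).1
  have hgraph₁ : PolyTimeComputable (push code) fun x => encodeGraph (G x.1) := hgraph.lift
  have hgraph₂ : PolyTimeComputable (push (push code)) fun x => encodeGraph (G x.1.1) :=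
    hgraph₁.lift
  -- The two pushed numbers are the player and the profile number. They range over all of `ℕ`; the
  -- player is confined to `Fin (n a)` only by the outer loop.
  have hi : PolyTimeNat (push (push code)) fun x => x.1.2 := PolyTimeNat.var.lift
  have hd : PolyTimeNat (push (push code)) fun x => x.2 := PolyTimeNat.var
  have hvalue' : ∀ S : ∀ x : (I × ℕ) × ℕ, Finset (Fin (n x.1.1)),
      (PolyTimeComputable (push (push code)) fun x => encodeCoalition (S x)) →
      PolyTimeComputable (push (push code)) fun x => encodeRat (v x.1.1 (S x)) := fun S hS =>
    (hvalue.restrict fun x : (I × ℕ) × ℕ => ⟨x.1.1, S x⟩).comp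
      (polyTimeComputable_encodePair (PolyTimeComputable.id (code := code)).lift.lift hS)
  have hW : PolyTimeNat (push (push code)) fun x =>
      profileWeight (n x.1.1) (G x.1.1).firstTwin x.1.2 x.2 :=
    polyTimeNat_profileWeight (G := fun x : (I × ℕ) × ℕ => G x.1.1) hgraph₂ hi hd
  have hT := polyTimeNat_numProfiles (G := fun x : I × ℕ => G x.1) hgraph₁ .var hn.lift
    fun _ => le_rfl
  -- The decomposition enters only here: it makes the number of profiles, and hence of rounds of the
  -- inner loop, polynomial.
  have hTB : PolyBounded (push code) fun x => numProfiles (n x.1) (G x.1).firstTwin x.2 (n x.1) :=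
    ((hnB.lift.add (.const 1)).pow k).mono fun x => numProfiles_le x.2
      (WeightedGraph.card_image_firstTwin_le_of_decomposition (hdecomp x.1)) (hrep x.1)
  have hq₁ := hvalue' _ (polyTimeComputable_joinedCoalition
    (G := fun x : (I × ℕ) × ℕ => G x.1.1) hgraph₂ hi hd)
  have hq₀ := hvalue' _ (polyTimeComputable_profileCoalition
    (G := fun x : (I × ℕ) × ℕ => G x.1.1) hgraph₂ hi hd)
  have hy : PolyTimeNat (push code) fun x => (n x.1).factorial := (hn.factorial hnB).lift
  have hy0 : ∀ x : I × ℕ, (n x.1).factorial ≠ 0 := fun x => Nat.factorial_ne_zero _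
  have hsum := polyTimeComputable_encodeRat_sum
    (W := fun (x : I × ℕ) d => profileWeight (n x.1) (G x.1).firstTwin x.2 d)
    (q₁ := fun (x : I × ℕ) d => v x.1 (joinedCoalition (n x.1) (G x.1).firstTwin x.2 d))
    (q₀ := fun (x : I × ℕ) d => v x.1 (profileCoalition (n x.1) (G x.1).firstTwin x.2 d))
    hT hTB hW hq₁ hq₀ hy hy0
  have hmain := hn.flatMap (f := fun a i => encodeRat ((∑ d ∈ Finset.range
    (numProfiles (n a) (G a).firstTwin i (n a)), (profileWeight (n a) (G a).firstTwin i d : ℚ) *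
      (v a (joinedCoalition (n a) (G a).firstTwin i d) -
        v a (profileCoalition (n a) (G a).firstTwin i d))) / (n a).factorial)) hnB hsum
  convert hmain using 2 with a
  rw [← flatten_ofFn_eq_flatMap, encodeShapley]
  congr 2
  funext i
  rw [CoopGame.shapley, rawShapley_eq_sum_profiles (hrep a) (v a) (fun S T h =>
    hbased a S T (WeightedGraph.isomorphic_of_card_eq h)) i, Fintype.card_fin]
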